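/- Let $P$ be a finite poset, with strict order written $a <_P b$, and let $\beta$ be a multiset of elements of $P$ in which $a\in P$ has multiplicity $n_a$. Say that two elements are incomparable if they are distinct and neither is less than the other in $P$. For a word $w=w_1\cdots w_n$ in the alphabet $P$ put $\mathrm{Des}_P(w)=\{i\in\{1,\dots,n-1\} : w_{i+1}<_P w_i\}$ and $$Q_{\mathrm{Des}_P(w)}(\mathbf x)=\sum_{\substack{1\le i_1\le\cdots\le i_n\\ j\in \mathrm{Des}_P(w)\Rightarrow i_j<i_{j+1}}} x_{i_1}\cdots x_{i_n},$$ and for a finite linear combination of words $\gamma=\sum_w\gamma_w\,w$ put $F_\gamma(\mathbf x)=\sum_w\gamma_w\,Q_{\mathrm{Des}_P(w)}(\mathbf x)$. Let $W_\beta$ be the sum of all words of content $\beta$ (that is, whose multiset of letters is $\beta$). Let $P[\beta]$ be the poset obtained from $P$ by replacing each $a\in P$ by $n_a$ copies $a^{(1)},\dots,a^{(n_a)}$, where $a^{(i)}<b^{(j)}$ if and only if $a<_P b$. Let $\mathcal K_\beta$ be the set of proper colorings $\kappa\colon P[\beta]\to\{1,2,\dots\}$ of the incomparability graph of $P[\beta]$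 such that $\kappa(a^{(1)})>\cdots>\kappa(a^{(n_a)})$ for all $a\in P$, and put $$X^\beta_{\mathrm{inc}(P)}(\mathbf x)=\sum_{\kappa\in\mathcal K_\beta}\ \prod_{b\in P[\beta]}x_{\kappa(b)}.$$ Let $\omega$ be the algebra involution of the ring of symmetric functions in $\mathbf x=(x_1,x_2,\dots)$ with $\omega h_\lambda=e_\lambda$ for all partitions $\lambda$. **Theorem.** (i) $X^\beta_{\mathrm{inc}(P)}(\mathbf x)$ is a symmetric function over $\mathbb Z$, and $$F_{W_\beta}(\mathbf x)=\omega X^\beta_{\mathrm{inc}(P)}(\mathbf x).$$ (ii) Suppose in addition that $P$ is a natural unit interval order, i.e. $P$ is equipped with a total order $<$ such that $a<_P b$ implies $a<b$, and such that $a<b<c$ whenever $a<_P c$ and $b$ is incomparable to both $a$ and $c$. Order $P[\beta]$ totally by $a^{(1)}<\cdots<a^{(n_a)}$, and $a^{(i)}<b^{(j)}$ whenever $a<b$. Define, with coefficients in $\mathbb Q(t)$, $$W_\beta(t)=\sum_{w\text{ of content }\beta}t^{\mathrm{inv}_P(w)}\,w,\qquad X^\beta_{\mathrm{inc}(P)}(\mathbf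 x,t)=\sum_{\kappa\in\mathcal K_\beta}t^{\mathrm{asc}(\kappa)}\prod_{b\in P[\beta]}x_{\kappa(b)},$$ where $\mathrm{inv}_P(w)$ is the number of pairs of positions $i<j$ such that $w_i>w_j$ and $w_i,w_j$ are incomparable in $P$, and $\mathrm{asc}(\kappa)$ is the number of pairs $(a,b)$ of elements of $P[\beta]$ that are incomparable and satisfy $a<b$ and $\kappa(a)<\kappa(b)$. Then $X^\beta_{\mathrm{inc}(P)}(\mathbf x,t)$ is a symmetric function over $\mathbb Q(t)$, and $$F_{W_\beta(t)}(\mathbf x)=\omega X^\beta_{\mathrm{inc}(P)}(\mathbf x,t).$$ -/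

import Mathlib

/-! ### Symmetric functions in the variables `x_0, x_1, x_2, …` -/

/-- The ring `Λ` of symmetric functions over `R`: the formal power series of bounded degree in
countably many variables that are invariant under all permutations of the variables. -/
noncomputable def SymmFun (R : Type*) [CommRing R] : Subalgebra R (MvPowerSeries ℕ R) where
  carrier := {f | (∀ σ : Equiv.Perm ℕ, MvPowerSeries.renameEquiv R σ f = f) ∧
    ∃ n : ℕ, ∀ d : ℕ →₀ ℕ, MvPowerSeries.coeff d f ≠ 0 → d.degree ≤ n}
  mul_mem' := by
    classical
    rintro f g ⟨hf, n, hn⟩ ⟨hg, m, hm⟩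
    refine ⟨fun σ => by rw [map_mul, hf, hg], n + m, fun d hd => ?_⟩
    rw [MvPowerSeries.coeff_mul] at hd
    obtain ⟨p, hp, hne⟩ := Finset.exists_ne_zero_of_sum_ne_zero hd
    rw [← Finset.HasAntidiagonal.mem_antidiagonal.mp hp, map_add]
    exact Nat.add_le_add (hn _ (left_ne_zero_of_mul hne)) (hm _ (right_ne_zero_of_mul hne))
  add_mem' := by
    rintro f g ⟨hf, n, hn⟩ ⟨hg, m, hm⟩
    refine ⟨fun σ => by rw [map_add, hf, hg], max n m, fun d hd => ?_⟩
    rw [map_add] at hd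
    by_cases h : MvPowerSeries.coeff d f = 0
    · rw [h, zero_add] at hd
      exact le_max_of_le_right (hm _ hd)
    · exact le_max_of_le_left (hn _ h)
  algebraMap_mem' := by
    classical
    intro r
    refine ⟨fun σ => AlgEquiv.commutes _ r, 0, fun d hd => ?_⟩
    rw [MvPowerSeries.algebraMap_apply, Algebra.algebraMap_self, RingHom.id_apply,
      MvPowerSeries.coeff_C] at hd
    by_cases h : d = 0
    · simp [h]
    · simp [h] at hd

/-- A family of coefficients that is unchanged under permuting the entries of the exponent and
vanishes in large degree is a symmetric function. -/
theorem mem_symmFun_of_coeff {R : Type*} [CommRing R] {f : MvPowerSeries ℕ R}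
    (h : ∀ (σ : Equiv.Perm ℕ) (d : ℕ →₀ ℕ),
      MvPowerSeries.coeff (d.embDomain σ.toEmbedding) f = MvPowerSeries.coeff d f)
    (n : ℕ) (hn : ∀ d : ℕ →₀ ℕ, MvPowerSeries.coeff d f ≠ 0 → d.degree ≤ n) :
    f ∈ SymmFun R := by
  refine ⟨fun σ => ?_, n, hn⟩
  ext d
  obtain ⟨d, rfl⟩ : ∃ d' : ℕ →₀ ℕ, d'.embDomain σ.toEmbedding = d :=
    ⟨d.embDomain σ.symm.toEmbedding, by
      ext i
      obtain ⟨i, rfl⟩ := σ.surjective i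
      have h1 := Finsupp.embDomain_apply_self σ.toEmbedding
        (d.embDomain σ.symm.toEmbedding) i
      have h2 := Finsupp.embDomain_apply_self σ.symm.toEmbedding d (σ i)
      simp only [Equiv.coe_toEmbedding, Equiv.symm_apply_apply] at h1 h2
      rw [h1, h2]⟩
  rw [h]
  exact MvPowerSeries.coeff_embDomain_rename σ.toEmbedding f d

theorem coeff_embDomain_of_mem_symmFun {R : Type*} [CommRing R] {f : MvPowerSeries ℕ R}
    (hf : f ∈ SymmFun R) (σ : Equiv.Perm ℕ) (d : ℕ →₀ ℕ) :
    MvPowerSeries.coeff (d.embDomain σ.toEmbedding) f = MvPowerSeries.coeff d f := by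
  conv_lhs => rw [← hf.1 σ]
  exact MvPowerSeries.coeff_embDomain_rename σ.toEmbedding f d

theorem degree_embDomain_eq {α β : Type*} (e : α ↪ β) (d : α →₀ ℕ) :
    (d.embDomain e).degree = d.degree := by
  simp [Finsupp.degree_apply, Finsupp.support_embDomain]

open Classical in
/-- The sum of all squarefree monomials of degree `k`. -/
noncomputable def elemSeries (R : Type*) [CommRing R] (k : ℕ) : MvPowerSeries ℕ R :=
  fun d => if d.degree = k ∧ ∀ i, d i ≤ 1 then 1 else 0

/-- The sum of all monomials of degree `k`. -/
noncomputable def homogSeries (R : Type*) [CommRing R] (k : ℕ) : MvPowerSeries ℕ R :=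
  fun d => if d.degree = k then 1 else 0

open Classical in
theorem coeff_elemSeries (R : Type*) [CommRing R] (k : ℕ) (d : ℕ →₀ ℕ) :
    MvPowerSeries.coeff d (elemSeries R k) =
      if d.degree = k ∧ ∀ i, d i ≤ 1 then 1 else 0 := rfl

theorem coeff_homogSeries (R : Type*) [CommRing R] (k : ℕ) (d : ℕ →₀ ℕ) :
    MvPowerSeries.coeff d (homogSeries R k) = if d.degree = k then 1 else 0 := rfl

/-- The elementary symmetric function `e_k`. -/
noncomputable def SymmFun.e (R : Type*) [CommRing R] (k : ℕ) : SymmFun R :=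
  ⟨elemSeries R k, by
    classical
    refine mem_symmFun_of_coeff (fun σ d => ?_) k (fun d hd => ?_)
    · have : (∀ i, (d.embDomain σ.toEmbedding) i ≤ 1) ↔ ∀ i, d i ≤ 1 := by
        rw [← σ.forall_congr_right]
        exact forall_congr' fun i => by
          rw [← Finsupp.embDomain_apply_self σ.toEmbedding d i]; rfl
      rw [coeff_elemSeries, coeff_elemSeries, degree_embDomain_eq]
      exact if_congr (and_congr_right fun _ => this) rfl rfl
    · by_contra hk
      exact hd ((coeff_elemSeries R k d).trans (if_neg fun h => hk h.1.le))⟩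

/-- The complete homogeneous symmetric function `h_k`. -/
noncomputable def SymmFun.h (R : Type*) [CommRing R] (k : ℕ) : SymmFun R :=
  ⟨homogSeries R k, by
    refine mem_symmFun_of_coeff (fun σ d => ?_) k (fun d hd => ?_)
    · simp only [coeff_homogSeries, degree_embDomain_eq]
    · by_contra hk
      exact hd ((coeff_homogSeries R k d).trans (if_neg fun h => hk h.le))⟩

/-! ### The involution `ω`

`Λ` is the polynomial ring in `e_1, e_2, …`; the facts below prove this, and `ω` is then the
algebra map with `ω e_k = h_k`. -/

/-- The algebra map `R[y_0, y_1, …] → Λ` with `y_k ↦ e_{k+1}`. -/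
noncomputable def SymmFun.ofE (R : Type*) [CommRing R] : MvPolynomial ℕ R →ₐ[R] SymmFun R :=
  MvPolynomial.aeval fun k => SymmFun.e R (k + 1)

/-- Setting all variables but the first `n` to zero. -/
noncomputable def SymmFun.res (R : Type*) [CommRing R] (n : ℕ) :
    SymmFun R →ₐ[R] MvPowerSeries (Fin n) R :=
  (MvPowerSeries.killCompl (R := R) (Fin.valEmbedding (n := n))).comp (SymmFun R).val

theorem SymmFun.coeff_res {R : Type*} [CommRing R] (n : ℕ) (f : SymmFun R) (d : Fin n →₀ ℕ) :
    MvPowerSeries.coeff d (SymmFun.res R n f) =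
      MvPowerSeries.coeff (d.embDomain Fin.valEmbedding) (f : MvPowerSeries ℕ R) := rfl

open Classical in
theorem coeff_esymm_fin (R : Type*) [CommRing R] (n k : ℕ) (d : Fin n →₀ ℕ) :
    MvPolynomial.coeff d (MvPolynomial.esymm (Fin n) R k) =
      if d.degree = k ∧ ∀ i, d i ≤ 1 then 1 else 0 := by
  rw [MvPolynomial.esymm_eq_sum_monomial, MvPolynomial.coeff_sum]
  simp only [MvPolynomial.coeff_monomial]
  have key : ∀ (t : Finset (Fin n)) (i : Fin n),
      (∑ j ∈ t, Finsupp.single j 1 : Fin n →₀ ℕ) i = if i ∈ t then 1 else 0 := by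
    intro t i
    simp [Finsupp.finsetSum_apply, Finsupp.single_apply]
  have hdeg : ∀ t : Finset (Fin n),
      (∑ j ∈ t, Finsupp.single j 1 : Fin n →₀ ℕ).degree = t.card := by
    intro t
    simp
  split_ifs with h
  · have hd : (∑ j ∈ d.support, Finsupp.single j 1 : Fin n →₀ ℕ) = d := by
      ext i
      rw [key]
      have := h.2 i
      by_cases hi : d i = 0
      · simp [hi]
      · rw [if_pos (Finsupp.mem_support_iff.2 hi)]
        omega
    rw [Finset.sum_eq_single d.support, if_pos hd]
    · intro t _ ht
      refine if_neg fun he => ht ?_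
      ext i
      rw [Finsupp.mem_support_iff, ← he, key]
      simp
    · intro hn
      refine absurd ?_ hn
      rw [Finset.mem_powersetCard]
      exact ⟨Finset.subset_univ _, by rw [← hdeg, hd, h.1]⟩
  · refine Finset.sum_eq_zero fun t ht => if_neg fun he => h ?_
    rw [← he]
    refine ⟨by rw [hdeg, (Finset.mem_powersetCard.1 ht).2], fun i => ?_⟩
    rw [key]
    split_ifs <;> simp

theorem SymmFun.res_e (R : Type*) [CommRing R] (n k : ℕ) :
    SymmFun.res R n (SymmFun.e R k) = (MvPolynomial.esymm (Fin n) R k : MvPowerSeries (Fin n) R) := by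
  classical
  ext d
  rw [SymmFun.coeff_res, MvPolynomial.coeff_coe, coeff_esymm_fin]
  refine (coeff_elemSeries R k _).trans (if_congr ?_ rfl rfl)
  rw [degree_embDomain_eq]
  refine and_congr_right fun _ => ⟨fun h i => ?_, fun h i => ?_⟩
  · rw [← Finsupp.embDomain_apply_self Fin.valEmbedding d i]
    exact h _
  · by_cases hi : i ∈ Set.range (Fin.valEmbedding (n := n))
    · obtain ⟨i, rfl⟩ := hi
      rw [Finsupp.embDomain_apply_self]
      exact h i
    · rw [Finsupp.embDomain_of_notMem_range _ _ _ hi]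
      exact Nat.zero_le _

theorem SymmFun.res_ofE (R : Type*) [CommRing R] (n : ℕ) (q : MvPolynomial (Fin n) R) :
    SymmFun.res R n (SymmFun.ofE R (MvPolynomial.rename Fin.val q)) =
      ((MvPolynomial.esymmAlgHom (Fin n) R n q).val : MvPowerSeries (Fin n) R) := by
  have : ((SymmFun.res R n).comp (SymmFun.ofE R)).comp (MvPolynomial.rename Fin.val) =
      ((MvPolynomial.coeToMvPowerSeries.algHom R).comp
        (MvPolynomial.symmetricSubalgebra (Fin n) R).val).comp
        (MvPolynomial.esymmAlgHom (Fin n) R n) := by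
    ext1 i
    simp only [AlgHom.comp_apply, MvPolynomial.rename_X, SymmFun.ofE, MvPolynomial.aeval_X,
      MvPolynomial.esymmAlgHom, SymmFun.res_e]
    simp
  have h := AlgHom.congr_fun this q
  simpa using h

theorem SymmFun.ofE_injective (R : Type*) [CommRing R] :
    Function.Injective (SymmFun.ofE R) := by
  rw [injective_iff_map_eq_zero]
  intro p hp
  obtain ⟨n, hn⟩ : ∃ n : ℕ, ∀ i ∈ p.vars, i < n :=
    ⟨p.vars.sup id + 1, fun i hi => Nat.lt_succ_of_le (Finset.le_sup (f := id) hi)⟩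
  obtain ⟨q, rfl⟩ := MvPolynomial.exists_rename_eq_of_vars_subset_range p
    (Fin.val : Fin n → ℕ) Fin.val_injective (fun i hi => ⟨⟨i, hn i hi⟩, rfl⟩)
  have h := SymmFun.res_ofE R n q
  rw [hp, map_zero] at h
  have h0 : (MvPolynomial.esymmAlgHom (Fin n) R n q).val = 0 := by
    apply MvPolynomial.coe_injective
    rw [← h, MvPolynomial.coe_zero]
  have h1 : q = 0 := by
    apply MvPolynomial.esymmAlgHom_fin_injective R le_rfl
    rw [map_zero]
    exact Subtype.ext h0
  rw [h1, map_zero]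

/-- The homogeneous component of degree `m` of a symmetric function. -/
noncomputable def SymmFun.component {R : Type*} [CommRing R] (m : ℕ) (f : SymmFun R) :
    SymmFun R :=
  ⟨MvPowerSeries.homogeneousComponent m (f : MvPowerSeries ℕ R), by
    refine mem_symmFun_of_coeff (fun σ d => ?_) m (fun d hd => ?_)
    · rw [MvPowerSeries.coeff_homogeneousComponent, MvPowerSeries.coeff_homogeneousComponent,
        degree_embDomain_eq, coeff_embDomain_of_mem_symmFun f.2]
    · rw [MvPowerSeries.coeff_homogeneousComponent] at hd
      by_contra hk
      exact hd (if_neg fun h => hk h.le)⟩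

theorem SymmFun.coeff_component {R : Type*} [CommRing R] (m : ℕ) (f : SymmFun R) (d : ℕ →₀ ℕ) :
    MvPowerSeries.coeff d (SymmFun.component m f : MvPowerSeries ℕ R) =
      if d.degree = m then MvPowerSeries.coeff d (f : MvPowerSeries ℕ R) else 0 :=
  MvPowerSeries.coeff_homogeneousComponent m d _

theorem SymmFun.component_mul_e {R : Type*} [CommRing R] (m k : ℕ) (f : SymmFun R) :
    SymmFun.component m (f * SymmFun.e R k) =
      if k ≤ m then SymmFun.component (m - k) f * SymmFun.e R k else 0 := by
  classical
  apply Subtype.ext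
  ext d
  have hE : ∀ b : ℕ →₀ ℕ, MvPowerSeries.coeff b (SymmFun.e R k : MvPowerSeries ℕ R) ≠ 0 →
      b.degree = k := by
    intro b hb
    by_contra hk
    exact hb ((coeff_elemSeries R k b).trans (if_neg fun h => hk h.1))
  rw [SymmFun.coeff_component]
  by_cases hk : k ≤ m
  · rw [if_pos hk, MulMemClass.coe_mul, MulMemClass.coe_mul, MvPowerSeries.coeff_mul,
      MvPowerSeries.coeff_mul]
    simp only [SymmFun.coeff_component]
    have hsum : ∀ p ∈ Finset.HasAntidiagonal.antidiagonal d, p.1.degree + p.2.degree = d.degree := by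
      intro p hp
      rw [← Finset.HasAntidiagonal.mem_antidiagonal.mp hp, map_add]
    by_cases hd : d.degree = m
    · rw [if_pos hd]
      refine Finset.sum_congr rfl fun p hp => ?_
      have h1 := hsum p hp
      by_cases hb : MvPowerSeries.coeff p.2 (SymmFun.e R k : MvPowerSeries ℕ R) = 0
      · rw [hb, mul_zero, mul_zero]
      · have h2 := hE _ hb
        rw [if_pos (by omega)]
    · rw [if_neg hd]
      refine (Finset.sum_eq_zero fun p hp => ?_).symm
      have h1 := hsum p hp
      by_cases hb : MvPowerSeries.coeff p.2 (SymmFun.e R k : MvPowerSeries ℕ R) = 0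
      · rw [hb, mul_zero]
      · have h2 := hE _ hb
        rw [if_neg (by omega), zero_mul]
  · rw [if_neg hk, ZeroMemClass.coe_zero, map_zero]
    split_ifs with hd
    · rw [MulMemClass.coe_mul, MvPowerSeries.coeff_mul]
      refine Finset.sum_eq_zero fun p hp => ?_
      have h1 : p.1.degree + p.2.degree = d.degree := by
        rw [← Finset.HasAntidiagonal.mem_antidiagonal.mp hp, map_add]
      by_cases hb : MvPowerSeries.coeff p.2 (SymmFun.e R k : MvPowerSeries ℕ R) = 0
      · rw [hb, mul_zero]
      · have h2 := hE _ hb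
        omega
    · rfl

theorem SymmFun.component_ofE_mem {R : Type*} [CommRing R] (p : MvPolynomial ℕ R) :
    ∀ m : ℕ, SymmFun.component m (SymmFun.ofE R p) ∈ (SymmFun.ofE R).range := by
  classical
  induction p using MvPolynomial.induction_on with
  | C r =>
    intro m
    rw [← MvPolynomial.algebraMap_eq, AlgHom.commutes]
    have : SymmFun.component m (algebraMap R (SymmFun R) r) =
        if m = 0 then algebraMap R (SymmFun R) r else 0 := by
      apply Subtype.ext
      ext d
      rw [SymmFun.coeff_component, Subalgebra.coe_algebraMap, MvPowerSeries.algebraMap_apply]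
      by_cases hm : m = 0
      · subst hm
        rw [if_pos rfl, Subalgebra.coe_algebraMap, MvPowerSeries.algebraMap_apply]
        split_ifs with hd
        · rfl
        · rw [MvPowerSeries.coeff_C, if_neg]
          rintro rfl
          exact hd (by simp)
      · rw [if_neg hm, ZeroMemClass.coe_zero, map_zero]
        split_ifs with hd
        · rw [MvPowerSeries.coeff_C, if_neg]
          rintro rfl
          exact hm (by simpa using hd.symm)
        · rfl
    rw [this]
    split_ifs
    · exact Subalgebra.algebraMap_mem _ r
    · exact Subalgebra.zero_mem _
  | add p q hp hq =>
    intro m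
    have : SymmFun.component m (SymmFun.ofE R (p + q)) =
        SymmFun.component m (SymmFun.ofE R p) + SymmFun.component m (SymmFun.ofE R q) := by
      apply Subtype.ext
      rw [map_add]
      exact map_add (MvPowerSeries.homogeneousComponent m) _ _
    rw [this]
    exact Subalgebra.add_mem _ (hp m) (hq m)
  | mul_X p i hp =>
    intro m
    have hX : SymmFun.ofE R (MvPolynomial.X i) = SymmFun.e R (i + 1) :=
      MvPolynomial.aeval_X _ i
    rw [map_mul, hX, SymmFun.component_mul_e]
    split_ifs
    · exact Subalgebra.mul_mem _ (hp _) ⟨MvPolynomial.X i, hX⟩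
    · exact Subalgebra.zero_mem _

/-- Exponents of degree at most `n` can be moved into the first `n` variables. -/
theorem exists_perm_embDomain (n : ℕ) (d : ℕ →₀ ℕ) (hd : d.degree ≤ n) :
    ∃ (σ : Equiv.Perm ℕ) (d' : Fin n →₀ ℕ),
      d.embDomain σ.toEmbedding = d'.embDomain Fin.valEmbedding := by
  classical
  have hcard : d.support.card ≤ n := by
    refine le_trans ?_ hd
    rw [Finsupp.degree_apply, Finset.card_eq_sum_ones]
    exact Finset.sum_le_sum fun i hi => Nat.one_le_iff_ne_zero.2 (Finsupp.mem_support_iff.1 hi)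
  let f : (d.support : Set ℕ) ↪ ℕ :=
    (d.support.equivFin.toEmbedding).trans Fin.valEmbedding
  obtain ⟨σ, hσ⟩ := Cardinal.extend_function_of_lt f
    ((Cardinal.lt_aleph0_of_finite _).trans_eq Cardinal.mk_nat.symm) ⟨Equiv.refl ℕ⟩
  refine ⟨σ, (d.embDomain σ.toEmbedding).comapDomain Fin.val Fin.val_injective.injOn, ?_⟩
  have hrange : (↑(d.embDomain σ.toEmbedding).support : Set ℕ) ⊆
      Set.range (Fin.val : Fin n → ℕ) := by
    intro i hi
    rw [Finsupp.support_embDomain] at hi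
    simp only [Finset.coe_map, Set.mem_image] at hi
    obtain ⟨j, hj, rfl⟩ := hi
    refine ⟨⟨σ j, ?_⟩, rfl⟩
    have := hσ ⟨j, hj⟩
    rw [this]
    exact lt_of_lt_of_le (d.support.equivFin ⟨j, hj⟩).2 hcard
  rw [Finsupp.embDomain_eq_mapDomain Fin.valEmbedding]
  exact (Finsupp.mapDomain_comapDomain _ Fin.val_injective _ hrange).symm

theorem SymmFun.ofE_surjective (R : Type*) [CommRing R] :
    Function.Surjective (SymmFun.ofE R) := by
  classical
  intro f
  obtain ⟨n, hn⟩ := f.2.2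
  let g : MvPolynomial (Fin n) R := MvPowerSeries.truncTotal (n + 1) (SymmFun.res R n f)
  have hg : (g : MvPowerSeries (Fin n) R) = SymmFun.res R n f := by
    ext d
    rw [MvPolynomial.coeff_coe]
    by_cases hd : d.degree < n + 1
    · exact MvPowerSeries.coeff_truncTotal _ hd
    · rw [show MvPolynomial.coeff d g = 0 from MvPowerSeries.coeff_truncTotal_eq_zero _ (by omega)]
      by_contra h
      have := hn _ (Ne.symm h)
      rw [degree_embDomain_eq] at this
      omega
  have hsymm : g.IsSymmetric := by
    intro σ
    apply MvPolynomial.coe_injective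
    rw [← MvPowerSeries.rename_coe, hg]
    ext d
    obtain ⟨d, rfl⟩ : ∃ d' : Fin n →₀ ℕ, d'.embDomain σ.toEmbedding = d :=
      ⟨d.embDomain σ.symm.toEmbedding, by
        ext i
        obtain ⟨i, rfl⟩ := σ.surjective i
        have h1 := Finsupp.embDomain_apply_self σ.toEmbedding
          (d.embDomain σ.symm.toEmbedding) i
        have h2 := Finsupp.embDomain_apply_self σ.symm.toEmbedding d (σ i)
        simp only [Equiv.coe_toEmbedding, Equiv.symm_apply_apply] at h1 h2
        rw [h1, h2]⟩
    refine (MvPowerSeries.coeff_embDomain_rename σ.toEmbedding (SymmFun.res R n f) d).trans ?_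
    rw [SymmFun.coeff_res, SymmFun.coeff_res,
      ← coeff_embDomain_of_mem_symmFun f.2 (σ.viaEmbedding Fin.valEmbedding)]
    congr 1
    congr 1
    simp only [Finsupp.embDomain_eq_mapDomain, ← Finsupp.mapDomain_comp]
    congr 1
    ext i
    simpa using congrArg id (Equiv.Perm.viaEmbedding_apply σ Fin.valEmbedding i)
  obtain ⟨q, hq⟩ := (MvPolynomial.esymmAlgHom_fin_bijective R n).2 ⟨g, hsymm⟩
  set x : SymmFun R := SymmFun.ofE R (MvPolynomial.rename Fin.val q) with hx
  have hres : SymmFun.res R n x = SymmFun.res R n f := by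
    rw [hx, SymmFun.res_ofE, hq, ← hg]
  have hmem : (∑ m ∈ Finset.range (n + 1), SymmFun.component m x) ∈ (SymmFun.ofE R).range :=
    Subalgebra.sum_mem _ fun m _ => SymmFun.component_ofE_mem _ m
  suffices h : (∑ m ∈ Finset.range (n + 1), SymmFun.component m x) = f by
    rw [h] at hmem
    exact hmem
  set r : SymmFun R := ∑ m ∈ Finset.range (n + 1), SymmFun.component m x with hr
  have hcr : ∀ d : ℕ →₀ ℕ, MvPowerSeries.coeff d (r : MvPowerSeries ℕ R) =
      if d.degree ≤ n then MvPowerSeries.coeff d (x : MvPowerSeries ℕ R) else 0 := by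
    intro d
    rw [hr, AddSubmonoidClass.coe_finsetSum, map_sum]
    simp only [SymmFun.coeff_component]
    simp
  apply Subtype.ext
  ext d
  by_cases hd : d.degree ≤ n
  · obtain ⟨σ, d', h'⟩ := exists_perm_embDomain n d hd
    rw [← coeff_embDomain_of_mem_symmFun r.2 σ, ← coeff_embDomain_of_mem_symmFun f.2 σ, h', hcr,
      ← SymmFun.coeff_res, ← SymmFun.coeff_res, hres, ← h', degree_embDomain_eq, if_pos hd]
  · rw [hcr, if_neg hd]
    by_contra h
    exact hd (hn d (Ne.symm h))

/-- The algebra endomorphism `ω` of `Λ` with `ω e_k = h_k` for all `k`; it also satisfies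
`ω h_k = e_k`, hence `ω h_λ = e_λ` for all partitions `λ`. -/
noncomputable def SymmFun.omega (R : Type*) [CommRing R] : SymmFun R →ₐ[R] SymmFun R :=
  (MvPolynomial.aeval fun k => SymmFun.h R (k + 1)).comp
    (AlgEquiv.ofBijective (SymmFun.ofE R)
      ⟨SymmFun.ofE_injective R, SymmFun.ofE_surjective R⟩).symm.toAlgHom

theorem SymmFun.e_zero (R : Type*) [CommRing R] : SymmFun.e R 0 = 1 := by
  classical
  apply Subtype.ext
  ext d
  refine (coeff_elemSeries R 0 d).trans ?_
  rw [OneMemClass.coe_one, MvPowerSeries.coeff_one]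
  refine if_congr ⟨fun h => (Finsupp.degree_eq_zero_iff d).1 h.1, ?_⟩ rfl rfl
  rintro rfl
  simp

theorem SymmFun.h_zero (R : Type*) [CommRing R] : SymmFun.h R 0 = 1 := by
  classical
  apply Subtype.ext
  ext d
  refine (coeff_homogSeries R 0 d).trans ?_
  rw [OneMemClass.coe_one, MvPowerSeries.coeff_one]
  exact if_congr (Finsupp.degree_eq_zero_iff d) rfl rfl

theorem SymmFun.omega_e (R : Type*) [CommRing R] (k : ℕ) :
    SymmFun.omega R (SymmFun.e R k) = SymmFun.h R k := by
  cases k with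
  | zero => rw [SymmFun.e_zero, SymmFun.h_zero, map_one]
  | succ k =>
    have : SymmFun.e R (k + 1) = SymmFun.ofE R (MvPolynomial.X k) :=
      (MvPolynomial.aeval_X (fun k => SymmFun.e R (k + 1)) k).symm
    rw [this, SymmFun.omega, AlgHom.comp_apply]
    have h2 : (AlgEquiv.ofBijective (SymmFun.ofE R)
      ⟨SymmFun.ofE_injective R, SymmFun.ofE_surjective R⟩).symm.toAlgHom
        (SymmFun.ofE R (MvPolynomial.X k)) = MvPolynomial.X k :=
      AlgEquiv.ofBijective_symm_apply_apply _ _ _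
    rw [h2, MvPolynomial.aeval_X]

theorem SymmFun.sum_e_mul_h (R : Type*) [CommRing R] (n : ℕ) (hn : n ≠ 0) :
    ∑ p ∈ Finset.HasAntidiagonal.antidiagonal n,
      (-1 : R) ^ p.1 • (SymmFun.e R p.1 * SymmFun.h R p.2) = 0 := by
  classical
  apply Subtype.ext
  ext d
  rw [AddSubmonoidClass.coe_finsetSum, map_sum, ZeroMemClass.coe_zero, map_zero]
  have h1 : ∀ p : ℕ × ℕ, MvPowerSeries.coeff d
      (((-1 : R) ^ p.1 • (SymmFun.e R p.1 * SymmFun.h R p.2) : SymmFun R) : MvPowerSeries ℕ R) =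
      ∑ q ∈ Finset.HasAntidiagonal.antidiagonal d,
        if (∀ i, q.1 i ≤ 1) ∧ (q.1.degree, q.2.degree) = p then (-1 : R) ^ q.1.degree else 0 := by
    intro p
    rw [SetLike.val_smul, MvPowerSeries.coeff_smul, MulMemClass.coe_mul, MvPowerSeries.coeff_mul,
      Finset.mul_sum]
    refine Finset.sum_congr rfl fun q _ => ?_
    rw [show MvPowerSeries.coeff q.1 (SymmFun.e R p.1 : MvPowerSeries ℕ R) = _ from
        coeff_elemSeries R p.1 q.1,
      show MvPowerSeries.coeff q.2 (SymmFun.h R p.2 : MvPowerSeries ℕ R) = _ from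
        coeff_homogSeries R p.2 q.2]
    obtain ⟨p1, p2⟩ := p
    by_cases ha : q.1.degree = p1 <;> by_cases hb : q.2.degree = p2 <;>
      by_cases hc : ∀ i, q.1 i ≤ 1 <;> simp [ha, hb, hc]
  rw [Finset.sum_congr rfl fun p _ => h1 p, Finset.sum_comm]
  have h2 : ∀ q ∈ Finset.HasAntidiagonal.antidiagonal d,
      (∑ p ∈ Finset.HasAntidiagonal.antidiagonal n,
        if (∀ i, q.1 i ≤ 1) ∧ (q.1.degree, q.2.degree) = p then (-1 : R) ^ q.1.degree else 0) =
      if (∀ i, q.1 i ≤ 1) ∧ d.degree = n then (-1 : R) ^ q.1.degree else 0 := by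
    intro q hq
    have hq' : q.1.degree + q.2.degree = d.degree := by
      rw [← Finset.HasAntidiagonal.mem_antidiagonal.mp hq, map_add]
    by_cases hc : ∀ i, q.1 i ≤ 1
    · simp only [hc, implies_true, true_and]
      rw [Finset.sum_ite_eq]
      refine if_congr ?_ rfl rfl
      rw [Finset.HasAntidiagonal.mem_antidiagonal, hq']
    · simp [hc]
  rw [Finset.sum_congr rfl h2]
  by_cases hd : d.degree = n
  swap
  · simp [hd]
  simp only [hd, and_true]
  rw [← Finset.sum_filter]
  have key : ∀ (t : Finset ℕ) (i : ℕ),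
      (∑ j ∈ t, Finsupp.single j 1 : ℕ →₀ ℕ) i = if i ∈ t then 1 else 0 := by
    intro t i
    simp [Finsupp.finsetSum_apply, Finsupp.single_apply]
  have hsupp : d.support.Nonempty := by
    rw [Finsupp.support_nonempty_iff]
    rintro rfl
    exact hn (by simpa using hd.symm)
  have hz : ((∑ t ∈ d.support.powerset, (-1 : ℤ) ^ t.card : ℤ) : R) = 0 := by
    rw [Finset.sum_powerset_neg_one_pow_card_of_nonempty hsupp, Int.cast_zero]
  rw [← hz]
  push_cast
  symm
  refine Finset.sum_nbij' (fun t => (∑ j ∈ t, Finsupp.single j 1, d - ∑ j ∈ t, Finsupp.single j 1))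
    (fun q => q.1.support) ?_ ?_ ?_ ?_ ?_
  · intro t ht
    rw [Finset.mem_powerset] at ht
    rw [Finset.mem_filter, Finset.HasAntidiagonal.mem_antidiagonal]
    refine ⟨?_, fun i => ?_⟩
    · refine add_tsub_cancel_of_le fun i => ?_
      rw [key]
      split_ifs with hi
      · exact Nat.one_le_iff_ne_zero.2 (Finsupp.mem_support_iff.1 (ht hi))
      · exact Nat.zero_le _
    · simp only [key]
      split_ifs <;> simp
  · intro q hq
    rw [Finset.mem_filter, Finset.HasAntidiagonal.mem_antidiagonal] at hq
    rw [Finset.mem_powerset]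
    intro i hi
    rw [Finsupp.mem_support_iff] at hi ⊢
    rw [← hq.1, Finsupp.add_apply]
    omega
  · intro t _
    ext i
    rw [Finsupp.mem_support_iff, key]
    simp
  · intro q hq
    rw [Finset.mem_filter, Finset.HasAntidiagonal.mem_antidiagonal] at hq
    have h : (∑ j ∈ q.1.support, Finsupp.single j 1 : ℕ →₀ ℕ) = q.1 := by
      ext i
      rw [key]
      have := hq.2 i
      by_cases hi : q.1 i = 0
      · simp [hi]
      · rw [if_pos (Finsupp.mem_support_iff.2 hi)]
        omega
    refine Prod.ext h ?_
    simp only [h]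
    rw [← hq.1, add_tsub_cancel_left]
  · intro t _
    simp

theorem SymmFun.omega_h (R : Type*) [CommRing R] (k : ℕ) :
    SymmFun.omega R (SymmFun.h R k) = SymmFun.e R k := by
  classical
  induction k using Nat.strong_induction_on with
  | _ n ih =>
    rcases Nat.eq_zero_or_pos n with rfl | hn
    · rw [SymmFun.e_zero, SymmFun.h_zero, map_one]
    have h1 := congrArg (SymmFun.omega R) (SymmFun.sum_e_mul_h R n hn.ne')
    rw [map_zero, map_sum] at h1
    simp only [map_smul, map_mul, SymmFun.omega_e] at h1
    have h2 : ∑ p ∈ Finset.HasAntidiagonal.antidiagonal n,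
        (-1 : R) ^ p.1 • (SymmFun.h R p.1 * SymmFun.e R p.2) = 0 := by
      have h3 := congrArg (fun x => (-1 : R) ^ n • x) (SymmFun.sum_e_mul_h R n hn.ne')
      simp only [smul_zero, Finset.smul_sum] at h3
      rw [← h3, ← Finset.Nat.sum_antidiagonal_swap]
      refine Finset.sum_congr rfl fun p hp => ?_
      rw [Finset.HasAntidiagonal.mem_antidiagonal] at hp
      rw [smul_smul, Prod.fst_swap, Prod.snd_swap, ← hp, mul_comm (SymmFun.h R p.2), pow_add,
        mul_right_comm, ← pow_add, Even.neg_one_pow ⟨p.1, rfl⟩, one_mul]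
    have h4 := h1.trans h2.symm
    rw [← sub_eq_zero, ← Finset.sum_sub_distrib,
      Finset.sum_eq_single (0, n)] at h4
    · simp only [pow_zero, one_smul, SymmFun.h_zero, one_mul] at h4
      exact sub_eq_zero.1 h4
    · rintro ⟨a, b⟩ hp hne
      rw [Finset.HasAntidiagonal.mem_antidiagonal] at hp
      have hb : b < n := by
        rcases Nat.eq_zero_or_pos a with rfl | ha
        · exact absurd (by simpa using hp) (fun h : b = n => hne (by rw [h]))
        · simp only at hp
          omega
      rw [ih b hb, sub_self]
    · intro h
      exact absurd (Finset.HasAntidiagonal.mem_antidiagonal.2 (zero_add n)) h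

theorem SymmFun.omega_omega (R : Type*) [CommRing R] (f : SymmFun R) :
    SymmFun.omega R (SymmFun.omega R f) = f := by
  obtain ⟨p, rfl⟩ := SymmFun.ofE_surjective R f
  have : ((SymmFun.omega R).comp (SymmFun.omega R)).comp (SymmFun.ofE R) = SymmFun.ofE R := by
    ext1 i
    simp only [AlgHom.comp_apply, SymmFun.ofE, MvPolynomial.aeval_X, SymmFun.omega_e,
      SymmFun.omega_h]
  exact AlgHom.congr_fun this p

/-! ### Sums of monomials indexed by maps to `ℕ` -/

/-- The exponent of the monomial `∏_{v ∈ V} x_{κ(v)}`. -/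
noncomputable def monomialExponent {V : Type*} [Fintype V] (κ : V → ℕ) : ℕ →₀ ℕ :=
  ∑ v, Finsupp.single (κ v) 1

/-- The formal power series `∑_{κ ∈ S} wt(κ) ∏_{v ∈ V} x_{κ(v)}`, given by its coefficients;
each of these is a finite sum. -/
noncomputable def monomialSum {V : Type*} [Fintype V] {R : Type*} [CommRing R]
    (S : Set (V → ℕ)) (wt : (V → ℕ) → R) : MvPowerSeries ℕ R :=
  fun d => ∑ᶠ κ ∈ {κ | κ ∈ S ∧ monomialExponent κ = d}, wt κ

theorem finite_monomialExponent_eq {V : Type*} [Fintype V] (S : Set (V → ℕ)) (d : ℕ →₀ ℕ) :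
    {κ | κ ∈ S ∧ monomialExponent κ = d}.Finite := by
  classical
  refine (Set.Finite.pi' (fun _ : V => d.support.finite_toSet)).subset ?_
  rintro κ ⟨-, rfl⟩ v
  simp only [Finset.mem_coe, Finsupp.mem_support_iff, monomialExponent, Finsupp.finsetSum_apply]
  refine (Finset.sum_pos' (fun _ _ => Nat.zero_le _) ⟨v, Finset.mem_univ v, ?_⟩).ne'
  simp

/-! ### Words in the alphabet `P` and their quasisymmetric functions -/

/-- The relation "incomparable or equal" in a poset. -/
def IncompOrEq {P : Type*} [PartialOrder P] (a b : P) : Prop := ¬ a < b ∧ ¬ b < a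

/-- The fundamental quasisymmetric function `Q_D` in degree `n`, for `D ⊆ {1, …, n - 1}`: the sum
of `x_{i_1} ⋯ x_{i_n}` over `i_1 ≤ ⋯ ≤ i_n` with `i_j < i_{j+1}` for `j ∈ D`.
In the code the positions are numbered from `0`. -/
noncomputable def fundamentalQuasisymmetric (R : Type*) [CommRing R] (n : ℕ) (D : Set ℕ) :
    MvPowerSeries ℕ R :=
  monomialSum {i : Fin n → ℕ | Monotone i ∧
    ∀ (j : ℕ) (hj : j + 1 < n), j + 1 ∈ D → i ⟨j, Nat.lt_of_succ_lt hj⟩ < i ⟨j + 1, hj⟩}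
    fun _ => 1

/-- The `P`-descent set of a word `w_1 ⋯ w_n`: all `j ∈ {1, …, n - 1}` with `w_{j+1} < w_j` in `P`.
In the code the letters are numbered from `0`. -/
def descentSet {P : Type*} [PartialOrder P] (w : List P) : Set ℕ :=
  {m | ∃ (j : ℕ) (hj : j + 1 < w.length), m = j + 1 ∧ w[j + 1] < w[j]}

/-- `F_γ = ∑_w γ_w Q_{Des_P(w)}` for a finite linear combination `γ = ∑_w γ_w w` of words. -/
noncomputable def wordQuasisymmetric {P : Type*} [PartialOrder P] {R : Type*} [CommRing R]
    (γ : List P →₀ R) : MvPowerSeries ℕ R :=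
  γ.sum fun w c => c • fundamentalQuasisymmetric R w.length (descentSet w)

/-- The finite set of all words of content `β`. -/
def wordsOfContent {P : Type*} [DecidableEq P] (β : Multiset P) : Finset (List P) :=
  β.lists.toFinset

theorem mem_wordsOfContent {P : Type*} [DecidableEq P] (β : Multiset P) (w : List P) :
    w ∈ wordsOfContent β ↔ (w : Multiset P) = β := by
  rw [wordsOfContent, Multiset.mem_toFinset, Multiset.mem_lists_iff, eq_comm]
  rfl

/-- `W_β`, the sum of all words of content `β`. -/
noncomputable def contentSum {P : Type*} [DecidableEq P] (β : Multiset P) : List P →₀ ℤ :=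
  ∑ w ∈ wordsOfContent β, Finsupp.single w 1

/-- `inv_P(w)` with respect to a total order `lt` on `P`: the number of pairs of positions `i < j`
such that `w_j` is smaller than `w_i` in the total order and `w_i`, `w_j` are incomparable in `P`. -/
noncomputable def incompInversions {P : Type*} [PartialOrder P] (lt : P → P → Prop)
    (w : List P) : ℕ :=
  Set.ncard {p : Fin w.length × Fin w.length |
    p.1 < p.2 ∧ lt (w.get p.2) (w.get p.1) ∧ IncompOrEq (w.get p.1) (w.get p.2)}

/-- `W_β(t) = ∑_w t^{inv_P(w)} w`, the sum over all words of content `β`, with coefficients in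
`ℚ(t)`. -/
noncomputable def contentSumT {P : Type*} [DecidableEq P] [PartialOrder P] (lt : P → P → Prop)
    (β : Multiset P) : List P →₀ RatFunc ℚ :=
  ∑ w ∈ wordsOfContent β, Finsupp.single w (RatFunc.X ^ incompInversions lt w)

/-! ### Natural unit interval orders and multicolored chromatic symmetric functions -/

/-- The poset `P`, together with the strict total order `lt` on its elements, is a natural unit
interval order. -/
structure IsNaturalUnitIntervalOrder (P : Type*) [PartialOrder P] (lt : P → P → Prop) : Prop where
  total : IsStrictTotalOrder P lt
  lt_of_lt : ∀ a b : P, a < b → lt a b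
  between : ∀ a b c : P, a < c → IncompRel (· ≤ ·) a b → IncompRel (· ≤ ·) b c → lt a b ∧ lt b c

/-- The incomparability graph of a poset. -/
def incompGraph (P : Type*) [PartialOrder P] : SimpleGraph P where
  Adj a b := IncompRel (· ≤ ·) a b
  symm := ⟨fun _ _ h => h.symm⟩
  loopless := ⟨fun _ h => h.1 le_rfl⟩

/-- The underlying set of `P[β]`: the element `a` of `P` is replaced by as many copies as its
multiplicity in `β`, numbered from `0`. -/
def Blowup {P : Type*} [DecidableEq P] (β : Multiset P) : Type _ := Σ a : P, Fin (β.count a)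

instance {P : Type*} [DecidableEq P] [Fintype P] (β : Multiset P) : Fintype (Blowup β) :=
  inferInstanceAs (Fintype (Σ a : P, Fin (β.count a)))

/-- The partial order of `P[β]`: copies `a'` of `a` and `b'` of `b` satisfy `a' < b'` if and only
if `a < b` in `P`. -/
instance {P : Type*} [DecidableEq P] [PartialOrder P] (β : Multiset P) :
    PartialOrder (Blowup β) where
  le x y := x = y ∨ x.1 < y.1
  lt x y := x.1 < y.1
  le_refl x := Or.inl rfl
  le_trans x y z := by
    rintro (rfl | h) (rfl | h')
    · exact Or.inl rfl
    · exact Or.inr h'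
    · exact Or.inr h
    · exact Or.inr (h.trans h')
  lt_iff_le_not_ge x y := by
    constructor
    · intro h
      refine ⟨Or.inr h, ?_⟩
      rintro (rfl | h')
      · exact lt_irrefl _ h
      · exact lt_asymm h h'
    · rintro ⟨rfl | h, h'⟩
      · exact absurd (Or.inl rfl) h'
      · exact h
  le_antisymm x y := by
    rintro (rfl | h) (h' | h')
    · rfl
    · rfl
    · exact h'.symm
    · exact absurd h' (lt_asymm h)

/-- The total order on `P[β]` induced by a total order on `P`: copies of different elements are
compared as in `P`, copies of the same element by their number. -/
def Blowup.totalLT {P : Type*} [DecidableEq P] (lt : P → P → Prop) (β : Multiset P) :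
    Blowup β → Blowup β → Prop :=
  Sigma.Lex lt fun _ i j => i < j

/-- The proper colorings `κ` of the incomparability graph of `P[β]` that satisfy
`κ(a^{(1)}) > ⋯ > κ(a^{(n_a)})` on the copies of every `a ∈ P`. -/
def multicolorings {P : Type*} [DecidableEq P] [PartialOrder P] (β : Multiset P) :
    Set (Blowup β → ℕ) :=
  {κ | (∀ x y, (incompGraph (Blowup β)).Adj x y → κ x ≠ κ y) ∧
    ∀ (a : P) (i j : Fin (β.count a)), i < j → κ ⟨a, j⟩ < κ ⟨a, i⟩}

/-- The number of ascents of a coloring `κ` of a poset `Q` with respect to a total order `lt`: the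
number of pairs `(a, b)` with `a` before `b` in the total order, `a` and `b` incomparable in `Q`,
and `κ(a) < κ(b)`. -/
noncomputable def ascents {Q : Type*} [PartialOrder Q] (lt : Q → Q → Prop) (κ : Q → ℕ) : ℕ :=
  Set.ncard {p : Q × Q | lt p.1 p.2 ∧ IncompOrEq p.1 p.2 ∧ κ p.1 < κ p.2}

/-- The `β`-multicolored chromatic symmetric function of the incomparability graph of `P`. -/
noncomputable def multicoloredChromatic {P : Type*} [Fintype P] [DecidableEq P] [PartialOrder P]
    (β : Multiset P) : MvPowerSeries ℕ ℤ :=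
  monomialSum (multicolorings β) fun _ => 1

/-- The `β`-multicolored `t`-chromatic symmetric function of the incomparability graph of a natural
unit interval order `P`, with coefficients in `ℚ(t)`. -/
noncomputable def multicoloredChromaticT {P : Type*} [Fintype P] [DecidableEq P] [PartialOrder P]
    (lt : P → P → Prop) (β : Multiset P) : MvPowerSeries ℕ (RatFunc ℚ) :=
  monomialSum (multicolorings β) fun κ => RatFunc.X ^ ascents (Blowup.totalLT lt β) κ

/-! ### Linear functionals on symmetric functions and `ω` -/

/-! Write `e_d` and `h_d` for the products of the `e_{d_i}` and of the `h_{d_i}`, and `[x^d]` for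
taking a coefficient. The numbers `[x^ν] e_d` and `[x^ν] h_d` count matrices with row sums `d` and
column sums `ν`, with entries in `{0,1}` in the first case and arbitrary in the second; transposing
matrices exchanges `d` and `ν`. Hence for `X = e_ν` the functional `L = [x^ν]` satisfies `[x^d] X =
L(e_d)` and `[x^d] ωX = L(h_d)` for all `d`. By linearity every symmetric function `X` has such an
`L`, and the first family of equations determines it because the `e_d` span `Λ`
(`SymmFun.coeff_omega_of_coeff_eq`). So it suffices to find one linear functional `ψ` on `Λ` with
`[x^d] X^β = ψ(e_d)` and `[x^d] F = ψ(h_d)`. The symmetry of `X^β` is then automatic, since `e_d`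
does not change when the entries of `d` are permuted.

The functional comes from noncommuting variables `u_a`, `a ∈ P`: operators that append letters to
the argument of a function on words. They act on functions that are multiplied by a prescribed
factor when two neighbouring letters are interchanged, such as `g(w) = t^{inv_P(w)}` on words of
content `β`, extended by `0`. Applying `u_{w_1} ⋯ u_{w_n}` to `g` and evaluating at the empty word
gives `g(w)`. Let `e_k(u)` be the sum of the monomials of strictly decreasing words and `h_k(u)`
that of descent-free words. They satisfy the usual alternating relation (`sum_ncElem_mul_ncHomog`).
If the `e_k(u)` commute, there is an algebra map `G` on `Λ` with `e_k ↦ e_k(u)`, and then `h_k ↦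
h_k(u)`; take `ψ` to be `G` followed by the evaluation. Color classes of a multicoloring are chains,
that is, decreasing words, so products of `e_k(u)` enumerate multicolorings (`bijOn_multicolorings`,
`ascents_eq_incompInversions`). Products of `h_k(u)` enumerate words cut into descent-free blocks,
which are the coefficients of `F` (`coeff_fundamental_descentSet`).

It remains that the `e_k(u)` commute. In (i) the variables themselves commute. In (ii) comparable
letters commute, and incomparable `a < b` satisfy `u_a u_b = t⁻¹ u_b u_a`. Here the claim is proved
by adding the elements of `P` one at a time in the total order, in a joint induction with a symmetry
of the commutators between two initial segments (`commute_and_symmCommutator`). -/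

theorem finsupp_prod_eq_range_prod {M : Type*} [CommMonoid M] (f : ℕ → M) (h0 : f 0 = 1)
    (d : ℕ →₀ ℕ) (N : ℕ) (hN : d.support ⊆ Finset.range N) :
    (d.prod fun _ k => f k) = ∏ i ∈ Finset.range N, f (d i) := by
  refine Finset.prod_subset hN fun i _ hi => ?_
  simp only [Finsupp.notMem_support_iff.1 hi, h0]

theorem finsupp_exists_support_subset_range (d : ℕ →₀ ℕ) :
    ∃ N, d.support ⊆ Finset.range N :=
  ⟨d.support.sup id + 1, fun _ hi =>
    Finset.mem_range.2 (Nat.lt_succ_of_le (Finset.le_sup (f := id) hi))⟩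

theorem degree_eq_sum_range (d : ℕ →₀ ℕ) (N : ℕ) (hN : d.support ⊆ Finset.range N) :
    d.degree = ∑ i ∈ Finset.range N, d i := by
  rw [Finsupp.degree_apply]
  exact Finset.sum_subset hN fun i _ hi => Finsupp.notMem_support_iff.1 hi

/-! ### Matrices with prescribed row and column sums. -/

/-- The transpose of a finitely supported matrix. -/
noncomputable def finsuppTranspose (l : ℕ →₀ ℕ →₀ ℕ) : ℕ →₀ ℕ →₀ ℕ :=
  (l.uncurry.equivMapDomain (Equiv.prodComm ℕ ℕ)).curry

theorem finsuppTranspose_apply (l : ℕ →₀ ℕ →₀ ℕ) (i j : ℕ) :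
    finsuppTranspose l i j = l j i := by
  simp [finsuppTranspose, Finsupp.curry_apply, Finsupp.uncurry_apply]

theorem finsuppTranspose_transpose (l : ℕ →₀ ℕ →₀ ℕ) :
    finsuppTranspose (finsuppTranspose l) = l := by
  ext i j
  rw [finsuppTranspose_apply, finsuppTranspose_apply]

/-- The support hypotheses confine the matrix to an `N × N` square, so that transposition exchanges
the two kinds of sums. The condition `p 0` covers the entries of the transpose that come from the
zero rows outside the square. -/
theorem finsuppTranspose_mem {N : ℕ} {d μ : ℕ →₀ ℕ} (hd : d.support ⊆ Finset.range N)
    (hμ : μ.support ⊆ Finset.range N) {l : ℕ →₀ ℕ →₀ ℕ}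
    (hl : l ∈ (Finset.range N).finsuppAntidiag μ) (p : ℕ → Prop)
    (hp : ∀ i ∈ Finset.range N, (l i).degree = d i ∧ ∀ j, p (l i j)) (h0 : p 0) :
    finsuppTranspose l ∈ (Finset.range N).finsuppAntidiag d ∧
      ∀ i ∈ Finset.range N, (finsuppTranspose l i).degree = μ i ∧
        ∀ j, p (finsuppTranspose l i j) := by
  rw [Finset.mem_finsuppAntidiag] at hl ⊢
  obtain ⟨hs, hl⟩ := hl
  have hrow : ∀ i, i ∉ Finset.range N → l i = 0 := fun i hi =>
    Finsupp.notMem_support_iff.1 fun h => hi (hl h)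
  have hsum : ∀ j, ∑ i ∈ Finset.range N, l i j = μ j := by
    intro j
    rw [← hs, Finsupp.finsetSum_apply]
  have hcol : ∀ i j, j ∉ Finset.range N → l i j = 0 := by
    intro i j hj
    by_cases hi : i ∈ Finset.range N
    · have h1 := hsum j
      rw [Finsupp.notMem_support_iff.1 fun h => hj (hμ h)] at h1
      exact Finset.sum_eq_zero_iff.1 h1 i hi
    · rw [hrow i hi]; rfl
  have hdeg : ∀ i, (l i).degree = ∑ j ∈ Finset.range N, l i j := by
    intro i
    refine degree_eq_sum_range _ _ fun j hj => ?_
    by_contra h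
    exact Finsupp.mem_support_iff.1 hj (hcol i j h)
  refine ⟨⟨?_, ?_⟩, ?_⟩
  · ext i
    rw [Finsupp.finsetSum_apply]
    simp only [finsuppTranspose_apply]
    rw [← hdeg]
    by_cases hi : i ∈ Finset.range N
    · exact (hp i hi).1
    · rw [hrow i hi, Finsupp.notMem_support_iff.1 fun h => hi (hd h), map_zero]
  · intro j hj
    by_contra h
    refine Finsupp.mem_support_iff.1 hj ?_
    ext i
    rw [finsuppTranspose_apply, hcol i j h]
    rfl
  · intro j _
    constructor
    · rw [← hsum, degree_eq_sum_range _ N]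
      · simp only [finsuppTranspose_apply]
      · intro i hi
        by_contra h
        refine Finsupp.mem_support_iff.1 hi ?_
        rw [finsuppTranspose_apply, hrow i h]
        rfl
    · intro i
      rw [finsuppTranspose_apply]
      by_cases hi : i ∈ Finset.range N
      · exact (hp i hi).2 j
      · rw [hrow i hi]
        exact h0

-- Expanding the product chooses one exponent `l i` for each factor: these are the rows of a matrix
-- with row sums `d` and column sums `μ`.
open Classical in
theorem coeff_range_prod {R : Type*} [CommRing R] (f : ℕ → MvPowerSeries ℕ R) (p : ℕ → Prop)
    (hf : ∀ k d, MvPowerSeries.coeff d (f k) = if d.degree = k ∧ ∀ i, p (d i) then 1 else 0)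
    (d μ : ℕ →₀ ℕ) (N : ℕ) :
    MvPowerSeries.coeff μ (∏ i ∈ Finset.range N, f (d i)) =
      (((Finset.range N).finsuppAntidiag μ).filter fun l =>
        ∀ i ∈ Finset.range N, (l i).degree = d i ∧ ∀ j, p (l i j)).card := by
  rw [MvPowerSeries.coeff_prod, Finset.card_filter, Nat.cast_sum]
  refine Finset.sum_congr rfl fun l _ => ?_
  simp only [hf]
  rw [Finset.prod_ite_zero]
  simp

/-- The numbers of matrices with given row and column sums and restricted entries are symmetric
in the two kinds of sums. -/
theorem coeff_finsupp_prod_comm {R : Type*} [CommRing R] (f : ℕ → MvPowerSeries ℕ R)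
    (hf0 : f 0 = 1) (p : ℕ → Prop) (h0 : p 0)
    (hf : ∀ k d, MvPowerSeries.coeff d (f k) = open Classical in
      if d.degree = k ∧ ∀ i, p (d i) then 1 else 0) (d μ : ℕ →₀ ℕ) :
    MvPowerSeries.coeff μ (d.prod fun _ k => f k) =
      MvPowerSeries.coeff d (μ.prod fun _ k => f k) := by
  classical
  obtain ⟨N, hN⟩ := finsupp_exists_support_subset_range (d + μ)
  have hd : d.support ⊆ Finset.range N := fun i hi => hN (by
    rw [Finsupp.mem_support_iff] at hi ⊢
    rw [Finsupp.add_apply]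
    omega)
  have hμ : μ.support ⊆ Finset.range N := fun i hi => hN (by
    rw [Finsupp.mem_support_iff] at hi ⊢
    rw [Finsupp.add_apply]
    omega)
  rw [finsupp_prod_eq_range_prod f hf0 d N hd, finsupp_prod_eq_range_prod f hf0 μ N hμ,
    coeff_range_prod f p hf, coeff_range_prod f p hf]
  congr 1
  refine Finset.card_bij' (fun l _ => finsuppTranspose l) (fun l _ => finsuppTranspose l) ?_ ?_
    (fun l _ => finsuppTranspose_transpose l) (fun l _ => finsuppTranspose_transpose l)
  · intro l hl
    rw [Finset.mem_filter] at hl ⊢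
    exact finsuppTranspose_mem hd hμ hl.1 p hl.2 h0
  · intro l hl
    rw [Finset.mem_filter] at hl ⊢
    exact finsuppTranspose_mem hμ hd hl.1 p hl.2 h0

/-! ### The products `e_d` and `h_d`, and coefficients as linear functionals. -/

/-- The product of the `e_{d_i}`. -/
noncomputable def SymmFun.eProd (R : Type*) [CommRing R] (d : ℕ →₀ ℕ) : SymmFun R :=
  d.prod fun _ k => SymmFun.e R k

/-- The product of the `h_{d_i}`. -/
noncomputable def SymmFun.hProd (R : Type*) [CommRing R] (d : ℕ →₀ ℕ) : SymmFun R :=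
  d.prod fun _ k => SymmFun.h R k

theorem SymmFun.coe_finsupp_prod {R : Type*} [CommRing R] (f : ℕ → SymmFun R) (d : ℕ →₀ ℕ) :
    ((d.prod fun _ k => f k : SymmFun R) : MvPowerSeries ℕ R) =
      d.prod fun _ k => (f k : MvPowerSeries ℕ R) :=
  map_finsuppProd (SymmFun R).val d _

theorem SymmFun.coeff_eProd_comm (R : Type*) [CommRing R] (d μ : ℕ →₀ ℕ) :
    MvPowerSeries.coeff μ (SymmFun.eProd R d : MvPowerSeries ℕ R) =
      MvPowerSeries.coeff d (SymmFun.eProd R μ : MvPowerSeries ℕ R) := by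
  rw [SymmFun.eProd, SymmFun.eProd, SymmFun.coe_finsupp_prod, SymmFun.coe_finsupp_prod]
  refine coeff_finsupp_prod_comm (fun k => (SymmFun.e R k : MvPowerSeries ℕ R)) ?_
    (fun n => n ≤ 1) (Nat.zero_le _) (fun k d => coeff_elemSeries R k d) d μ
  rw [SymmFun.e_zero]
  rfl

theorem SymmFun.coeff_hProd_comm (R : Type*) [CommRing R] (d μ : ℕ →₀ ℕ) :
    MvPowerSeries.coeff μ (SymmFun.hProd R d : MvPowerSeries ℕ R) =
      MvPowerSeries.coeff d (SymmFun.hProd R μ : MvPowerSeries ℕ R) := by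
  rw [SymmFun.hProd, SymmFun.hProd, SymmFun.coe_finsupp_prod, SymmFun.coe_finsupp_prod]
  refine coeff_finsupp_prod_comm (fun k => (SymmFun.h R k : MvPowerSeries ℕ R)) ?_
    (fun _ => True) trivial (fun k d => ?_) d μ
  · rw [SymmFun.h_zero]
    rfl
  · refine (coeff_homogSeries R k d).trans ?_
    simp

theorem SymmFun.omega_eProd (R : Type*) [CommRing R] (d : ℕ →₀ ℕ) :
    SymmFun.omega R (SymmFun.eProd R d) = SymmFun.hProd R d := by
  rw [SymmFun.eProd, map_finsuppProd]
  simp only [SymmFun.omega_e]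
  rfl

theorem SymmFun.eProd_mul_e (R : Type*) [CommRing R] (d : ℕ →₀ ℕ) (k : ℕ) :
    ∃ d', SymmFun.eProd R d * SymmFun.e R k = SymmFun.eProd R d' := by
  classical
  obtain ⟨N, hN⟩ := finsupp_exists_support_subset_range d
  -- The position `N` lies outside the support of `d`, so the new factor is not merged with an old
  -- one.
  refine ⟨d + Finsupp.single N k, ?_⟩
  have hNd : d N = 0 := Finsupp.notMem_support_iff.1 fun h => by simpa using hN h
  have h1 : (d + Finsupp.single N k).support ⊆ Finset.range (N + 1) := by
    intro i hi
    rw [Finset.mem_range]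
    rcases Finset.mem_union.1 (Finsupp.support_add hi) with h | h
    · exact Nat.lt_succ_of_lt (Finset.mem_range.1 (hN h))
    · have := Finsupp.support_single_subset h
      rw [Finset.mem_singleton] at this
      omega
  rw [SymmFun.eProd, SymmFun.eProd, finsupp_prod_eq_range_prod _ (SymmFun.e_zero R) _ _ hN,
    finsupp_prod_eq_range_prod _ (SymmFun.e_zero R) _ _ h1, Finset.prod_range_succ]
  congr 1
  · refine Finset.prod_congr rfl fun i hi => ?_
    rw [Finset.mem_range] at hi
    simp [hi.ne']
  · simp [hNd]

theorem SymmFun.span_eProd (R : Type*) [CommRing R] :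
    Submodule.span R (Set.range (SymmFun.eProd R)) = ⊤ := by
  rw [Submodule.eq_top_iff']
  intro x
  obtain ⟨p, rfl⟩ := SymmFun.ofE_surjective R x
  induction p using MvPolynomial.induction_on with
  | C r =>
    rw [← MvPolynomial.algebraMap_eq, AlgHom.commutes, Algebra.algebraMap_eq_smul_one]
    refine Submodule.smul_mem _ _ (Submodule.subset_span ⟨0, ?_⟩)
    rw [SymmFun.eProd, Finsupp.prod_zero_index]
  | add p q hp hq =>
    rw [map_add]
    exact Submodule.add_mem _ hp hq
  | mul_X p i hp =>
    have hX : SymmFun.ofE R (MvPolynomial.X i) = SymmFun.e R (i + 1) :=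
      MvPolynomial.aeval_X _ i
    rw [map_mul, hX]
    generalize SymmFun.ofE R p = y at hp
    induction hp using Submodule.span_induction with
    | mem x hx =>
      obtain ⟨d, rfl⟩ := hx
      obtain ⟨d', h⟩ := SymmFun.eProd_mul_e R d (i + 1)
      rw [h]
      exact Submodule.subset_span ⟨d', rfl⟩
    | zero =>
      rw [zero_mul]
      exact Submodule.zero_mem _
    | add x y _ _ hx hy =>
      rw [add_mul]
      exact Submodule.add_mem _ hx hy
    | smul a x _ hx =>
      rw [smul_mul_assoc]
      exact Submodule.smul_mem _ _ hx

/-- For `X = e_ν` the functional is the coefficient of `x^ν`: both equations are then the symmetry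
of matrix counts under transposition, since `ω e_ν = h_ν`. Linearity does the rest, because the
`e_ν` span. -/
theorem SymmFun.exists_functional {R : Type*} [CommRing R] (X : SymmFun R) :
    ∃ L : SymmFun R →ₗ[R] R, ∀ d,
      MvPowerSeries.coeff d (X : MvPowerSeries ℕ R) = L (SymmFun.eProd R d) ∧
      MvPowerSeries.coeff d (SymmFun.omega R X : MvPowerSeries ℕ R) = L (SymmFun.hProd R d) := by
  have hX : X ∈ Submodule.span R (Set.range (SymmFun.eProd R)) := by
    rw [SymmFun.span_eProd]
    trivial
  induction hX using Submodule.span_induction with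
  | mem x hx =>
    obtain ⟨ν, rfl⟩ := hx
    refine ⟨(MvPowerSeries.coeff ν).comp (SymmFun R).val.toLinearMap, fun d => ⟨?_, ?_⟩⟩
    · exact SymmFun.coeff_eProd_comm R ν d
    · rw [SymmFun.omega_eProd]
      exact SymmFun.coeff_hProd_comm R ν d
  | zero => exact ⟨0, fun d => by simp⟩
  | add x y _ _ hx hy =>
    obtain ⟨L, hL⟩ := hx
    obtain ⟨L', hL'⟩ := hy
    refine ⟨L + L', fun d => ?_⟩
    rw [map_add, AddMemClass.coe_add, AddMemClass.coe_add, map_add, map_add, (hL d).1, (hL d).2,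
      (hL' d).1, (hL' d).2]
    exact ⟨rfl, rfl⟩
  | smul a x _ hx =>
    obtain ⟨L, hL⟩ := hx
    refine ⟨a • L, fun d => ?_⟩
    rw [map_smul, SetLike.val_smul, SetLike.val_smul, map_smul, map_smul, (hL d).1, (hL d).2]
    exact ⟨rfl, rfl⟩

/-- If the coefficients of `X` are the values of a linear functional on the products of `e_k`, then
those of `ω X` are its values on the products of `h_k`. -/
theorem SymmFun.coeff_omega_of_coeff_eq {R : Type*} [CommRing R] (X : SymmFun R)
    (ψ : SymmFun R →ₗ[R] R)
    (h : ∀ d, MvPowerSeries.coeff d (X : MvPowerSeries ℕ R) = ψ (SymmFun.eProd R d))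
    (d : ℕ →₀ ℕ) :
    MvPowerSeries.coeff d (SymmFun.omega R X : MvPowerSeries ℕ R) = ψ (SymmFun.hProd R d) := by
  obtain ⟨L, hL⟩ := SymmFun.exists_functional X
  have : L = ψ := by
    refine LinearMap.ext_on (SymmFun.span_eProd R) ?_
    rintro _ ⟨d, rfl⟩
    rw [← h, (hL d).1]
  rw [(hL d).2, this]

/-! ### Commutation of elementary functions in `q`-commuting variables -/

section QuasiCommuting

variable {R B : Type*} [CommRing R] [Ring B] [Algebra R B]

/-- The sequence `a n i`, `i = 0, 1, …`, of the elementary functions of the chains in the first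
`n` elements of a unit interval order, in variables `u` that commute or `q`-commute. -/
structure IsUnitIntervalElementary (q : R) (f : ℕ → ℕ) (u : ℕ → B) (a : ℕ → ℕ → B) : Prop where
  mono : Monotone f
  le : ∀ n, f n ≤ n
  comm : ∀ n k, k < f n → u k * u n = u n * u k
  qcomm : ∀ n k, f n ≤ k → k < n → u k * u n = q • (u n * u k)
  zero_right : ∀ n, a n 0 = 1
  zero_succ : ∀ i, a 0 (i + 1) = 0
  succ_succ : ∀ n i, a (n + 1) (i + 1) = a n (i + 1) + u n * a (f n) i

namespace IsUnitIntervalElementary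

variable {q : R} {f : ℕ → ℕ} {u : ℕ → B} {a : ℕ → ℕ → B}

/-- Only variables `u k` with `k < f n` occur in `a j`, and these commute with `u n`. -/
theorem commute_of_le (H : IsUnitIntervalElementary q f u a) (n : ℕ) :
    ∀ j ≤ f n, ∀ i, a j i * u n = u n * a j i := by
  intro j
  induction j using Nat.strong_induction_on with
  | _ j ih =>
    intro hj i
    cases i with
    | zero => rw [H.zero_right, one_mul, mul_one]
    | succ i =>
      cases j with
      | zero => rw [H.zero_succ, zero_mul, mul_zero]
      | succ j =>
        have hf := H.le j
        rw [H.succ_succ, add_mul, mul_add, ih j (by omega) (by omega), mul_assoc,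
          ih (f j) (by omega) (by omega), ← mul_assoc, ← mul_assoc, H.comm n j (by omega)]

/-- A chain contains at most one element with index in `[f n, n)`, since these elements are pairwise
incomparable. So `a j` is `a (f n)`, which commutes with `u n`, plus a part in which exactly one
variable `q`-commutes with `u n`. -/
theorem mul_eq_of_le (H : IsUnitIntervalElementary q f u a) (n : ℕ) :
    ∀ j, f n ≤ j → j ≤ n → ∀ i, a j i * u n = u n * ((1 - q) • a (f n) i + q • a j i) := by
  intro j hj
  induction j, hj using Nat.le_induction with
  | base =>
    intro _ i
    rw [← add_smul, sub_add_cancel, one_smul, H.commute_of_le n _ le_rfl]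
  | succ j hj ih =>
    intro hjn i
    cases i with
    | zero =>
      rw [H.zero_right, H.zero_right, ← add_smul, sub_add_cancel, one_smul, one_mul, mul_one]
    | succ i =>
      rw [H.succ_succ, add_mul, ih (by omega), mul_assoc,
        H.commute_of_le n (f j) (H.mono (by omega)), ← mul_assoc, H.qcomm n j hj (by omega)]
      simp only [mul_add, smul_add, smul_mul_assoc, mul_smul_comm, mul_assoc]
      abel

/-- The chains that leave the first `l` elements are sorted by their largest element `k`. -/
theorem sub_eq_sum (H : IsUnitIntervalElementary q f u a) (l i : ℕ) :
    ∀ m, l ≤ m → a m (i + 1) = a l (i + 1) + ∑ k ∈ Finset.Ico l m, u k * a (f k) i := by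
  intro m hm
  induction m, hm using Nat.le_induction with
  | base => simp
  | succ m hm ih => rw [H.succ_succ, ih, Finset.sum_Ico_succ_top hm, add_assoc]

/-- The pairs of elementary functions with indices `l` and `m` have symmetric commutators. -/
def SymmCommutator (a : ℕ → ℕ → B) (l m : ℕ) : Prop :=
  ∀ i j, a l i * a m j - a m j * a l i = a l j * a m i - a m i * a l j

/-- Moving `u k` to the left by `mul_eq_of_le` leaves a commutator of `a (f k)` with `a l` and a
product of two values of `a (f k)`; both are symmetric in `i`, `j` by hypothesis. -/
theorem q_commutator_symm (H : IsUnitIntervalElementary q f u a) {l k : ℕ} (hl : f k ≤ l)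
    (hk : l ≤ k) (hc : ∀ i j, a (f k) i * a (f k) j = a (f k) j * a (f k) i)
    (hs : SymmCommutator a (f k) l) (i j : ℕ) :
    q • (u k * a (f k) i * a l j) - a l j * (u k * a (f k) i) =
      q • (u k * a (f k) j * a l i) - a l i * (u k * a (f k) j) := by
  have key : ∀ i j, q • (u k * a (f k) i * a l j) - a l j * (u k * a (f k) i) =
      u k * (q • (a (f k) i * a l j - a l j * a (f k) i) - (1 - q) • (a (f k) j * a (f k) i)) := by
    intro i j
    rw [← mul_assoc (a l j), H.mul_eq_of_le k l hl hk]
    simp only [mul_add, mul_sub, add_mul, smul_sub, smul_mul_assoc, mul_smul_comm, mul_assoc]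
    abel
  rw [key, key, hs i j, hc i j]

/-- After `u m` is moved to the left, the contributions of `a (f m) (i + 1)` cancel. What remains of
`a l (i + 1)` are the chains whose largest element `k` is in `[f m, l)`, and each `k` contributes a
`q`-commutator that `q_commutator_symm` handles. -/
theorem commutator_symm (H : IsUnitIntervalElementary q f u a) {l m : ℕ} (hl : f m ≤ l)
    (hm : l ≤ m) (hc : ∀ n ≤ f m, ∀ i j, a n i * a n j = a n j * a n i)
    (hs : ∀ k, f m ≤ k → k < l → SymmCommutator a (f k) (f m)) (i j : ℕ) :
    a l (i + 1) * (u m * a (f m) j) - u m * a (f m) j * a l (i + 1) =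
      a l (j + 1) * (u m * a (f m) i) - u m * a (f m) i * a l (j + 1) := by
  have key : ∀ i j, a l (i + 1) * (u m * a (f m) j) - u m * a (f m) j * a l (i + 1) =
      u m * ∑ k ∈ Finset.Ico (f m) l,
        (q • (u k * a (f k) i * a (f m) j) - a (f m) j * (u k * a (f k) i)) := by
    intro i j
    rw [← mul_assoc, H.mul_eq_of_le m l hl hm, H.sub_eq_sum (f m) i l hl, Finset.sum_sub_distrib,
      ← Finset.smul_sum, ← Finset.sum_mul, ← Finset.mul_sum]
    generalize ∑ k ∈ Finset.Ico (f m) l, u k * a (f k) i = S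
    have := hc (f m) le_rfl (i + 1) j
    simp only [mul_add, mul_sub, add_mul, smul_add, sub_smul, one_smul, smul_mul_assoc,
      mul_smul_comm, mul_assoc, this, sub_mul]
    abel
  rw [key, key]
  congr 1
  refine Finset.sum_congr rfl fun k hk => ?_
  rw [Finset.mem_Ico] at hk
  have h1 : f k ≤ f m := H.mono (by omega)
  exact H.q_commutator_symm h1 hk.1 (hc _ h1) (hs k hk.1 hk.2) i j

/-- Commutativity for one more element needs the symmetry of commutators between smaller initial
segments, and conversely, whence the joint induction. The condition `f k ≤ l` for `k < m` says that
every element added between `l` and `m` has all elements below it among the first `l`; this is what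
`commutator_symm` requires. -/
theorem commute_and_symmCommutator (H : IsUnitIntervalElementary q f u a) (N : ℕ) :
    (∀ n ≤ N, ∀ i j, a n i * a n j = a n j * a n i) ∧
      ∀ l m, l ≤ m → m ≤ N → (∀ k < m, f k ≤ l) → SymmCommutator a l m := by
  induction N with
  | zero =>
    have h0 : ∀ i j, a 0 i * a 0 j = a 0 j * a 0 i := by
      intro i j
      cases i <;> cases j <;> simp [H.zero_right, H.zero_succ]
    constructor
    · intro n hn
      rw [Nat.le_zero.1 hn]
      exact h0
    · intro l m hl hm _ i j
      obtain rfl := Nat.le_zero.1 hm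
      obtain rfl := Nat.le_zero.1 hl
      rw [h0 i j, sub_self]
  | succ N ih =>
    obtain ⟨hc, hs⟩ := ih
    have hK : ∀ l m, f m ≤ l → l ≤ m → m ≤ N → ∀ i j,
        a l (i + 1) * (u m * a (f m) j) - u m * a (f m) j * a l (i + 1) =
          a l (j + 1) * (u m * a (f m) i) - u m * a (f m) i * a l (j + 1) := by
      intro l m hl hm hN
      have hfm := H.le m
      refine H.commutator_symm hl hm (fun n hn => hc n (by omega)) fun k hk hkl => ?_
      -- The side condition holds because `k' < f m ≤ k` gives `f k' ≤ f k`.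
      exact hs _ _ (H.mono (by omega)) (by omega) fun k' hk' => H.mono (by omega)
    have hc' : ∀ n ≤ N + 1, ∀ i j, a n i * a n j = a n j * a n i := by
      intro n hn i j
      rcases Nat.lt_or_ge N n with h | h
      · obtain rfl : n = N + 1 := by omega
        cases i with
        | zero => rw [H.zero_right, one_mul, mul_one]
        | succ i =>
          cases j with
          | zero => rw [H.zero_right, one_mul, mul_one]
          | succ j =>
            -- Both factors are expanded by the recursion. The old terms commute by induction
            -- (`h2`), the new ones because `u N` commutes with `a (f N)` (`h3`), and the mixed
            -- terms balance by `h1`.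
            have h1 := hK N N (H.le N) le_rfl le_rfl i j
            have h2 := hc N le_rfl (i + 1) (j + 1)
            have h3 : u N * a (f N) i * (u N * a (f N) j) =
                u N * a (f N) j * (u N * a (f N) i) := by
              rw [mul_assoc, ← mul_assoc (a (f N) i), H.commute_of_le N _ le_rfl, mul_assoc (u N),
                hc _ (H.le N) i j, mul_assoc (u N), ← mul_assoc (a (f N) j),
                H.commute_of_le N _ le_rfl, mul_assoc (u N)]
            rw [H.succ_succ, H.succ_succ, add_mul, mul_add, mul_add, add_mul, mul_add, mul_add, h2,
              h3]
            rw [sub_eq_sub_iff_add_eq_add] at h1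
            have h4 : ∀ x y z v w s : B, x + y = w + z → s + x + (y + v) = s + w + (z + v) := by
              intro x y z v w s h
              rw [add_assoc s, ← add_assoc x, h]
              abel
            exact h4 _ _ _ _ _ _ h1
      · exact hc n h i j
    refine ⟨hc', fun l m hl => ?_⟩
    induction m, hl using Nat.le_induction with
    | base =>
      intro hl _ i j
      rw [hc' l hl i j, sub_self]
    | succ m hm ih =>
      intro hN hf i j
      have ih' := ih (by omega) fun k hk => hf k (by omega)
      cases i with
      | zero => simp [H.zero_right]
      | succ i =>
        cases j with
        | zero => simp [H.zero_right]
        | succ j =>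
          have h1 := hK l m (hf m (by omega)) hm (by omega) i j
          have h2 := ih' (i + 1) (j + 1)
          rw [H.succ_succ, H.succ_succ, mul_add, add_mul, mul_add, add_mul,
            add_sub_add_comm, add_sub_add_comm, h1, h2]

theorem commute (H : IsUnitIntervalElementary q f u a) (n i j : ℕ) :
    a n i * a n j = a n j * a n i :=
  (H.commute_and_symmCommutator n).1 n le_rfl i j

end IsUnitIntervalElementary

end QuasiCommuting

/-! ### Noncommutative elementary and complete homogeneous functions -/

section WordProperties

variable {P : Type*}

/-- The word `w` is divided into blocks of the given lengths that all have the property `p`. -/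
def BlocksSatisfy (p : List P → Prop) : List ℕ → List P → Prop
  | [], _ => True
  | k :: ds, w => p (w.take k) ∧ BlocksSatisfy p ds (w.drop k)

variable [PartialOrder P]

/-- All pairs of neighbours in the word are descents. -/
def IsDecreasingWord (w : List P) : Prop := w.IsChain fun a b => b < a

/-- No pair of neighbours in the word is a descent. -/
def IsDescentFree (w : List P) : Prop := w.IsChain fun a b => ¬ b < a

theorem isDecreasingWord_iff_pairwise {w : List P} :
    IsDecreasingWord w ↔ w.Pairwise fun a b => b < a :=
  haveI : IsTrans P fun a b => b < a := ⟨fun _ _ _ h h' => lt_trans h' h⟩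
  List.isChain_iff_pairwise

-- A term is nonzero only if the descents of `w` are exactly its first `r` neighbouring pairs for
-- some `r`. Then just `i = r` and `i = r + 1` contribute, as the pair across the cut is
-- unconstrained, and their signs are opposite.
open Classical in
theorem sum_sign_split (w : List P) (hw : w ≠ []) :
    ∑ i ∈ Finset.range (w.length + 1),
      (if IsDecreasingWord (w.take i) ∧ IsDescentFree (w.drop i) then (-1 : ℤ) ^ i else 0) = 0 := by
  obtain ⟨a, w, rfl⟩ := List.exists_cons_of_ne_nil hw
  induction w generalizing a with
  | nil => simp [Finset.sum_range_succ, IsDecreasingWord, IsDescentFree]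
  | cons b w ih =>
    have ih := ih b (by simp)
    rw [List.length_cons, Finset.sum_range_succ'] at ih
    rw [List.length_cons, List.length_cons, Finset.sum_range_succ', Finset.sum_range_succ']
    simp only [IsDecreasingWord, IsDescentFree, List.take_succ_cons, List.drop_succ_cons,
      List.take_zero, List.drop_zero, List.isChain_cons_cons, List.isChain_nil,
      List.isChain_singleton, true_and, zero_add, pow_zero, pow_one] at ih ⊢
    by_cases hab : b < a
    · simp only [hab, true_and, not_true_eq_false, false_and, if_false, add_zero]
      have h : ∀ k, (-1 : ℤ) ^ (k + 1 + 1) = - (-1) ^ (k + 1) := fun k => by rw [pow_succ]; ring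
      simp only [h]
      rw [← neg_eq_zero, neg_add, ← Finset.sum_neg_distrib] at ih
      refine Eq.trans ?_ ih
      congr 1
      · refine Finset.sum_congr rfl fun k _ => ?_
        split_ifs <;> simp
      · split_ifs <;> simp
    · simp only [hab, false_and, if_false, Finset.sum_const_zero, not_false_eq_true, true_and,
        zero_add]
      split_ifs <;> simp

end WordProperties

/-! ### Sums of noncommutative monomials over words, and the alternating relation. -/

section WordSums

variable {P B : Type*} [Fintype P] [Ring B]

/-- The finite set of all words of length `n`. -/
noncomputable def wordsOfLength (P : Type*) [Fintype P] (n : ℕ) : Finset (List P) :=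
  (List.finite_length_eq P n).toFinset

theorem mem_wordsOfLength {n : ℕ} {w : List P} : w ∈ wordsOfLength P n ↔ w.length = n := by
  simp [wordsOfLength]

open Classical in
/-- The sum of the monomials `u_{w_1} ⋯ u_{w_n}` over all words `w` of length `n` with the
property `p`. -/
noncomputable def wordSum (u : P → B) (n : ℕ) (p : List P → Prop) : B :=
  ∑ w ∈ wordsOfLength P n with p w, (w.map u).prod

theorem wordSum_congr (u : P → B) (n : ℕ) {p q : List P → Prop}
    (h : ∀ w, w.length = n → (p w ↔ q w)) : wordSum u n p = wordSum u n q := by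
  classical
  exact Finset.sum_congr (Finset.filter_congr fun w hw => h w (mem_wordsOfLength.1 hw))
    fun _ _ => rfl

theorem wordSum_eq_zero (u : P → B) (n : ℕ) {p : List P → Prop}
    (h : ∀ w, w.length = n → ¬ p w) : wordSum u n p = 0 := by
  classical
  refine Finset.sum_eq_zero fun w hw => ?_
  rw [Finset.mem_filter, mem_wordsOfLength] at hw
  exact absurd hw.2 (h w hw.1)

theorem wordSum_zero (u : P → B) (p : List P → Prop) (hp : p []) : wordSum u 0 p = 1 := by
  classical
  have : (wordsOfLength P 0).filter p = {[]} := by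
    ext w
    rw [Finset.mem_filter, mem_wordsOfLength, List.length_eq_zero_iff, Finset.mem_singleton]
    exact ⟨fun h => h.1, fun h => ⟨h, h ▸ hp⟩⟩
  rw [wordSum]
  convert Finset.sum_congr this fun _ _ => rfl
  simp

theorem wordSum_mul (u : P → B) (i j : ℕ) (p q : List P → Prop) :
    wordSum u i p * wordSum u j q =
      wordSum u (i + j) fun w => p (w.take i) ∧ q (w.drop i) := by
  classical
  rw [wordSum, wordSum, wordSum, Finset.sum_mul_sum, ← Finset.sum_product']
  refine Finset.sum_nbij' (fun x => x.1 ++ x.2) (fun w => (w.take i, w.drop i)) ?_ ?_ ?_ ?_ ?_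
  · rintro ⟨v, w⟩ h
    simp only [Finset.mem_product, Finset.mem_filter, mem_wordsOfLength] at h ⊢
    obtain ⟨⟨rfl, hv⟩, rfl, hw⟩ := h
    simp [hv, hw]
  · intro w h
    simp only [Finset.mem_product, Finset.mem_filter, mem_wordsOfLength] at h ⊢
    simp [h.1, h.2]
  · rintro ⟨v, w⟩ h
    simp only [Finset.mem_product, Finset.mem_filter, mem_wordsOfLength] at h
    obtain ⟨⟨rfl, hv⟩, rfl, hw⟩ := h
    simp
  · intro w _
    simp
  · rintro ⟨v, w⟩ _
    simp

theorem prod_map_wordSum (u : P → B) (p : List P → Prop) (ds : List ℕ) :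
    (ds.map fun k => wordSum u k p).prod = wordSum u ds.sum (BlocksSatisfy p ds) := by
  induction ds with
  | nil => exact (wordSum_zero u _ trivial).symm
  | cons k ds ih =>
    rw [List.map_cons, List.prod_cons, ih, wordSum_mul, List.sum_cons]
    rfl

variable [PartialOrder P]

/-- The noncommutative elementary function of degree `k` in the variables `u`. -/
noncomputable def ncElem (u : P → B) (k : ℕ) : B := wordSum u k IsDecreasingWord

/-- The noncommutative complete homogeneous function of degree `k` in the variables `u`. -/
noncomputable def ncHomog (u : P → B) (k : ℕ) : B := wordSum u k IsDescentFree

theorem ncElem_zero (u : P → B) : ncElem u 0 = 1 := wordSum_zero u _ List.isChain_nil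

theorem ncHomog_zero (u : P → B) : ncHomog u 0 = 1 := wordSum_zero u _ List.isChain_nil

/-- The coefficient of each word is the alternating sum of `sum_sign_split`; no commutation of the
variables is involved. -/
theorem sum_ncElem_mul_ncHomog (u : P → B) (n : ℕ) (hn : n ≠ 0) :
    ∑ p ∈ Finset.HasAntidiagonal.antidiagonal n,
      (-1 : B) ^ p.1 * (ncElem u p.1 * ncHomog u p.2) = 0 := by
  classical
  rw [Finset.Nat.sum_antidiagonal_eq_sum_range_succ_mk]
  have h : ∀ i ∈ Finset.range n.succ, (-1 : B) ^ i * (ncElem u i * ncHomog u (n - i)) =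
      ∑ w ∈ wordsOfLength P n,
        ((if IsDecreasingWord (w.take i) ∧ IsDescentFree (w.drop i) then (-1 : ℤ) ^ i else 0 : ℤ) :
          B) * (w.map u).prod := by
    intro i hi
    rw [Finset.mem_range] at hi
    rw [ncElem, ncHomog, wordSum_mul, Nat.add_sub_cancel' (by omega), wordSum, Finset.sum_filter,
      Finset.mul_sum]
    refine Finset.sum_congr rfl fun w _ => ?_
    split_ifs <;> simp
  rw [Finset.sum_congr rfl h, Finset.sum_comm]
  refine Finset.sum_eq_zero fun w hw => ?_
  rw [mem_wordsOfLength] at hw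
  subst hw
  rw [← Finset.sum_mul, ← Int.cast_sum, sum_sign_split w (by rintro rfl; exact hn rfl),
    Int.cast_zero, zero_mul]

/-- The elementary functions of a poset with an element `m` that is not smaller than others. -/
theorem wordSum_decreasing_insert (u : P → B) (k : ℕ) (S : P → Prop) (m : P) (hm : ¬ S m)
    (hS : ∀ x, S x → ¬ m < x) :
    wordSum u (k + 1) (fun w => IsDecreasingWord w ∧ ∀ x ∈ w, x = m ∨ S x) =
      wordSum u (k + 1) (fun w => IsDecreasingWord w ∧ ∀ x ∈ w, S x) +
        u m * wordSum u k fun w => IsDecreasingWord w ∧ ∀ x ∈ w, S x ∧ x < m := by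
  classical
  -- A decreasing word that contains `m` starts with `m`, since an earlier letter would be larger
  -- than `m`.
  rw [wordSum, ← Finset.sum_filter_add_sum_filter_not _ fun w => m ∉ w]
  congr 1
  · refine Finset.sum_congr ?_ fun _ _ => rfl
    ext w
    simp only [Finset.mem_filter, and_assoc, and_congr_right_iff]
    intro _ _
    constructor
    · rintro ⟨h2, h3⟩
      exact fun x hx => (h2 x hx).resolve_left fun h => h3 (h ▸ hx)
    · intro h2
      exact ⟨fun x hx => Or.inr (h2 x hx), fun h => hm (h2 m h)⟩
  · rw [wordSum, Finset.mul_sum]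
    symm
    refine Finset.sum_nbij' (fun w => m :: w) List.tail ?_ ?_ ?_ ?_ ?_
    · intro w h
      simp only [Finset.mem_filter, mem_wordsOfLength, isDecreasingWord_iff_pairwise] at h ⊢
      obtain ⟨rfl, h1, h2⟩ := h
      refine ⟨⟨rfl, ?_, ?_⟩, ?_⟩
      · exact List.pairwise_cons.2 ⟨fun x hx => (h2 x hx).2, h1⟩
      · intro x hx
        rcases List.mem_cons.1 hx with h | h
        · exact Or.inl h
        · exact Or.inr (h2 x h).1
      · simp
    · intro w h
      simp only [Finset.mem_filter, mem_wordsOfLength, isDecreasingWord_iff_pairwise,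
        not_not] at h ⊢
      obtain ⟨⟨h0, h1, h2⟩, h3⟩ := h
      obtain ⟨a, w, rfl⟩ := List.exists_cons_of_length_eq_add_one h0
      rw [List.pairwise_cons] at h1
      have ha : a = m := by
        rcases List.mem_cons.1 h3 with h | h
        · exact h.symm
        · rcases h2 a List.mem_cons_self with h' | h'
          · exact h'
          · exact absurd (h1.1 m h) (hS a h')
      subst ha
      refine ⟨by simpa using h0, h1.2, fun x hx => ⟨?_, h1.1 x hx⟩⟩
      exact (h2 x (List.mem_cons_of_mem _ hx)).resolve_left (h1.1 x hx).ne
    · intro w _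
      rfl
    · intro w h
      simp only [Finset.mem_filter, mem_wordsOfLength, isDecreasingWord_iff_pairwise,
        not_not] at h
      obtain ⟨⟨h0, h1, h2⟩, h3⟩ := h
      obtain ⟨a, w, rfl⟩ := List.exists_cons_of_length_eq_add_one h0
      rw [List.pairwise_cons] at h1
      rcases List.mem_cons.1 h3 with h | h
      · rw [h, List.tail_cons]
      · rcases h2 a List.mem_cons_self with h' | h'
        · rw [h', List.tail_cons]
        · exact absurd (h1.1 m h) (hS a h')
    · intro w _
      simp

end WordSums

/-- Pairwise commuting elements `e_k` of an algebra are the images of the elementary symmetric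
functions. -/
theorem SymmFun.exists_algHom {R B : Type*} [CommRing R] [Ring B] [Algebra R B] (e : ℕ → B)
    (h0 : e 0 = 1) (hc : ∀ i j, e i * e j = e j * e i) :
    ∃ G : SymmFun R →ₐ[R] B, ∀ k, G (SymmFun.e R k) = e k := by
  -- Polynomials can be evaluated only in a commutative algebra, so the target is cut down to the
  -- subalgebra generated by the commuting elements.
  let S := Algebra.adjoin R (Set.range e)
  have hS : IsMulCommutative S := Algebra.isMulCommutative_adjoin R (by
    rintro _ ⟨i, rfl⟩ _ ⟨j, rfl⟩
    exact hc i j)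
  let : CommRing S := { (inferInstance : Ring S) with mul_comm := hS.is_comm.comm }
  let G' : MvPolynomial ℕ R →ₐ[R] S :=
    MvPolynomial.aeval fun k => ⟨e (k + 1), Algebra.subset_adjoin ⟨k + 1, rfl⟩⟩
  let F := AlgEquiv.ofBijective (SymmFun.ofE R)
      ⟨SymmFun.ofE_injective R, SymmFun.ofE_surjective R⟩
  refine ⟨(S.val.comp G').comp F.symm.toAlgHom, fun k => ?_⟩
  cases k with
  | zero => rw [SymmFun.e_zero, map_one, h0]
  | succ k =>
    have : SymmFun.e R (k + 1) = F (MvPolynomial.X k) :=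
      (MvPolynomial.aeval_X (fun k => SymmFun.e R (k + 1)) k).symm
    have h1 : F.symm (F (MvPolynomial.X k)) = MvPolynomial.X k := F.symm_apply_apply _
    rw [this]
    change S.val (G' (F.symm (F (MvPolynomial.X k)))) = _
    rw [h1]
    simp [G']

/-- Both sides satisfy the same alternating relation with the `e_k`, and this relation determines
the term of index `n` from the earlier ones. -/
theorem SymmFun.map_h_eq_ncHomog {R P B : Type*} [Fintype P] [PartialOrder P] [CommRing R] [Ring B]
    [Algebra R B] (u : P → B) (G : SymmFun R →ₐ[R] B)
    (hG : ∀ k, G (SymmFun.e R k) = ncElem u k) (n : ℕ) :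
    G (SymmFun.h R n) = ncHomog u n := by
  induction n using Nat.strong_induction_on with
  | _ n ih =>
    rcases Nat.eq_zero_or_pos n with rfl | hn
    · rw [SymmFun.h_zero, map_one, ncHomog_zero]
    have h1 := congrArg G (SymmFun.sum_e_mul_h R n hn.ne')
    rw [map_zero, map_sum] at h1
    have h2 := h1.trans (sum_ncElem_mul_ncHomog u n hn.ne').symm
    rw [← sub_eq_zero, ← Finset.sum_sub_distrib, Finset.sum_eq_single (0, n)] at h2
    · simpa [hG, ncElem_zero, sub_eq_zero] using h2
    · rintro ⟨a, b⟩ hp hne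
      rw [Finset.HasAntidiagonal.mem_antidiagonal] at hp
      have hb : b < n := by
        rcases Nat.eq_zero_or_pos a with rfl | ha
        · exact absurd (by simpa using hp) (fun h : b = n => hne (by rw [h]))
        · simp only at hp
          omega
      simp only [map_smul, map_mul, hG, ih b hb]
      rw [Algebra.smul_def, map_pow, map_neg, map_one, sub_self]
    · intro h
      exact absurd (Finset.HasAntidiagonal.mem_antidiagonal.2 (zero_add n)) h

/-! ### Words as operators -/

section LetterOperators

variable {P R : Type*} [CommRing R]

/-- The functions on words that are multiplied by `c a b` if neighbouring letters `a`, `b` are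
interchanged. -/
def quasiSymmetricFunctions (c : P → P → R) : Submodule R (List P → R) where
  carrier := {g | ∀ (s t : List P) (a b : P), g (s ++ b :: a :: t) = c a b * g (s ++ a :: b :: t)}
  add_mem' := by
    intro g g' h h' s t a b
    rw [Pi.add_apply, Pi.add_apply, h, h', mul_add]
  zero_mem' := by
    intro s t a b
    simp
  smul_mem' := by
    intro r g h s t a b
    rw [Pi.smul_apply, Pi.smul_apply, h, smul_eq_mul, smul_eq_mul, mul_left_comm]

/-- The operator that appends the letter `a` to the argument of a function on words. -/
def letterOperator (c : P → P → R) (a : P) : Module.End R (quasiSymmetricFunctions c) where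
  toFun g := ⟨fun w => g.1 (w ++ [a]), by
    intro s t x y
    have := g.2 s (t ++ [a]) x y
    simpa using this⟩
  map_add' _ _ := rfl
  map_smul' _ _ := rfl

theorem letterOperator_apply (c : P → P → R) (a : P) (g : quasiSymmetricFunctions c)
    (w : List P) : (letterOperator c a g).1 w = g.1 (w ++ [a]) := rfl

/-- The outer operator contributes the earlier letter, so a product of operators lists its letters
in the order of the word. The relation is therefore the defining condition of
`quasiSymmetricFunctions` at the end of a word. -/
theorem letterOperator_mul (c : P → P → R) (a b : P) :
    letterOperator c b * letterOperator c a =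
      c a b • (letterOperator c a * letterOperator c b) := by
  ext g w
  change g.1 (w ++ [b] ++ [a]) = c a b * g.1 (w ++ [a] ++ [b])
  simpa using g.2 w [] a b

theorem prod_letterOperator_apply (c : P → P → R) (g : quasiSymmetricFunctions c)
    (w v : List P) : ((w.map (letterOperator c)).prod g).1 v = g.1 (v ++ w) := by
  induction w generalizing v with
  | nil => simp
  | cons a w ih =>
    rw [List.map_cons, List.prod_cons, Module.End.mul_apply, letterOperator_apply, ih,
      List.append_assoc, List.singleton_append]

/-- The value at the empty word, as a linear functional on operators. -/
def evalNil (c : P → P → R) (g : quasiSymmetricFunctions c) :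
    Module.End R (quasiSymmetricFunctions c) →ₗ[R] R where
  toFun T := (T g).1 []
  map_add' _ _ := rfl
  map_smul' _ _ := rfl

theorem evalNil_prod (c : P → P → R) (g : quasiSymmetricFunctions c) (w : List P) :
    evalNil c g (w.map (letterOperator c)).prod = g.1 w :=
  prod_letterOperator_apply c g w []

open Classical in
theorem evalNil_wordSum [Fintype P] (c : P → P → R) (g : quasiSymmetricFunctions c) (n : ℕ)
    (p : List P → Prop) :
    evalNil c g (wordSum (letterOperator c) n p) = ∑ w ∈ wordsOfLength P n with p w, g.1 w := by
  rw [wordSum, map_sum]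
  exact Finset.sum_congr rfl fun w _ => evalNil_prod c g w

end LetterOperators

/-! ### Coefficients of quasisymmetric functions of words -/

/-- The word that consists of blocks of the letters `o, o + 1, …` of the given lengths. -/
def blockIndices : ℕ → List ℕ → List ℕ
  | _, [] => []
  | o, k :: ds => List.replicate k o ++ blockIndices (o + 1) ds

theorem length_blockIndices (o : ℕ) (ds : List ℕ) : (blockIndices o ds).length = ds.sum := by
  induction ds generalizing o with
  | nil => rfl
  | cons k ds ih => simp [blockIndices, ih]

theorem le_of_mem_blockIndices {o : ℕ} {ds : List ℕ} {j : ℕ} (h : j ∈ blockIndices o ds) :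
    o ≤ j := by
  induction ds generalizing o with
  | nil => simp [blockIndices] at h
  | cons k ds ih =>
    rcases List.mem_append.1 h with h | h
    · exact (List.eq_of_mem_replicate h).ge
    · exact (Nat.le_succ o).trans (ih h)

theorem pairwise_blockIndices (o : ℕ) (ds : List ℕ) :
    (blockIndices o ds).Pairwise (· ≤ ·) := by
  induction ds generalizing o with
  | nil => exact List.Pairwise.nil
  | cons k ds ih =>
    refine List.pairwise_append.2 ⟨?_, ih _, fun a ha b hb => ?_⟩
    · exact List.pairwise_replicate.2 (Or.inr le_rfl)
    · rw [List.eq_of_mem_replicate ha]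
      exact (Nat.le_succ o).trans (le_of_mem_blockIndices hb)

theorem count_blockIndices (o : ℕ) (ds : List ℕ) (j : ℕ) :
    (blockIndices o ds).count (o + j) = ds.getD j 0 := by
  induction ds generalizing o j with
  | nil => simp [blockIndices]
  | cons k ds ih =>
    rw [blockIndices, List.count_append, List.count_replicate]
    cases j with
    | zero =>
      have : (blockIndices (o + 1) ds).count (o + 0) = 0 := by
        rw [List.count_eq_zero]
        intro h
        have := le_of_mem_blockIndices h
        omega
      rw [this]
      simp
    | succ j =>
      have := ih (o + 1) j
      rw [show o + 1 + j = o + (j + 1) by omega] at this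
      rw [this]
      simp

/-- Indices are constant inside a block, which forbids descents there, and they increase strictly
from one block to the next, which allows anything. The offset `o` serves the induction. -/
theorem isChain_zip_blockIndices {P : Type*} [PartialOrder P] (o : ℕ) (ds : List ℕ) (w : List P)
    (hw : w.length = ds.sum) :
    ((blockIndices o ds).zip w).IsChain (fun x y => y.2 < x.2 → x.1 < y.1) ↔
      BlocksSatisfy IsDescentFree ds w := by
  induction ds generalizing o w with
  | nil => simp [blockIndices, BlocksSatisfy]
  | cons k ds ih =>
    rw [List.sum_cons] at hw
    have h1 : ((blockIndices o (k :: ds)).zip w) =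
        (List.replicate k o).zip (w.take k) ++ (blockIndices (o + 1) ds).zip (w.drop k) := by
      conv_lhs => rw [blockIndices, ← List.take_append_drop k w]
      refine List.zip_append ?_
      simp
      omega
    have h2 : ∀ (k : ℕ) (v : List P), v.length = k →
        (((List.replicate k o).zip v).IsChain (fun x y => y.2 < x.2 → x.1 < y.1) ↔
          IsDescentFree v) := by
      rintro _ v rfl
      have : (List.replicate v.length o).zip v = v.map fun a => (o, a) := by
        induction v with
        | nil => rfl
        | cons a v ihv => simp [List.replicate_succ, ihv]
      rw [this, List.isChain_map]
      simp [IsDescentFree]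
    rw [h1, List.isChain_append, h2 k _ (by simp; omega), ih (o + 1) _ (by simp; omega),
      BlocksSatisfy]
    refine and_congr_right fun _ => and_iff_left ?_
    rintro ⟨i, a⟩ hx ⟨j, b⟩ hy _
    have hi := List.eq_of_mem_replicate (List.of_mem_zip (List.mem_of_getLast? hx)).1
    have hj := le_of_mem_blockIndices (List.of_mem_zip (List.mem_of_head? hy)).1
    simp only at hi hj ⊢
    omega

theorem monomialExponent_apply {n : ℕ} (i : Fin n → ℕ) (j : ℕ) :
    monomialExponent i j = (List.ofFn i).count j := by
  rw [monomialExponent, Finsupp.finsetSum_apply]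
  induction n with
  | zero => simp
  | succ n ih =>
    rw [Fin.sum_univ_succ, ih fun k => i k.succ, List.ofFn_succ, List.count_cons, add_comm,
      Finsupp.single_apply]
    simp only [beq_iff_eq]

theorem sum_map_range (d : ℕ →₀ ℕ) (N : ℕ) (hN : d.support ⊆ Finset.range N) :
    ((List.range N).map d).sum = d.degree := by
  rw [degree_eq_sum_range d N hN]
  rfl

theorem getD_map_range (d : ℕ →₀ ℕ) (N : ℕ) (hN : d.support ⊆ Finset.range N) (j : ℕ) :
    ((List.range N).map d).getD j 0 = d j := by
  by_cases hj : j < N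
  · simp [hj]
  · rw [List.getD_eq_default _ _ (by simpa using hj)]
    exact (Finsupp.notMem_support_iff.1 fun h => hj (Finset.mem_range.1 (hN h))).symm

/-- A weakly increasing sequence is determined by its multiplicities. -/
theorem monotone_and_monomialExponent_eq_iff {n : ℕ} (i : Fin n → ℕ) (d : ℕ →₀ ℕ) (N : ℕ)
    (hN : d.support ⊆ Finset.range N) :
    (Monotone i ∧ monomialExponent i = d) ↔
      List.ofFn i = blockIndices 0 ((List.range N).map d) := by
  have hc : ∀ j, (blockIndices 0 ((List.range N).map d)).count j = d j := by
    intro j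
    have := count_blockIndices 0 ((List.range N).map d) j
    rwa [zero_add, getD_map_range d N hN] at this
  constructor
  · rintro ⟨h1, h2⟩
    refine List.Perm.eq_of_pairwise (le := (· ≤ ·)) (fun _ _ _ _ h h' => le_antisymm h h')
      ?_ (pairwise_blockIndices _ _) ?_
    · rw [List.pairwise_ofFn]
      exact fun a b h => h1 h.le
    · rw [List.perm_iff_count]
      intro j
      rw [← monomialExponent_apply, h2, hc]
  · intro h
    constructor
    · have := pairwise_blockIndices 0 ((List.range N).map d)
      rw [← h, List.pairwise_ofFn] at this
      intro a b hab
      rcases hab.lt_or_eq with h' | h'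
      · exact this h'
      · rw [h']
    · ext j
      rw [monomialExponent_apply, h, hc]

-- At most one index sequence has exponent `d`, namely `blockIndices 0 ds`. It is admissible exactly
-- when all descents of `w` lie at boundaries of blocks.
open Classical in
theorem coeff_fundamental_descentSet {P : Type*} [PartialOrder P] (R : Type*) [CommRing R]
    (w : List P) (d : ℕ →₀ ℕ) (N : ℕ) (hN : d.support ⊆ Finset.range N) :
    MvPowerSeries.coeff d (fundamentalQuasisymmetric R w.length (descentSet w)) =
      if w.length = d.degree ∧ BlocksSatisfy IsDescentFree ((List.range N).map d) w
      then 1 else 0 := by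
  set ds := (List.range N).map d with hds
  have hsum : ds.sum = d.degree := sum_map_range d N hN
  have hiff : ∀ i : Fin w.length → ℕ, (i ∈ {i : Fin w.length → ℕ | Monotone i ∧
      ∀ (j : ℕ) (hj : j + 1 < w.length), j + 1 ∈ descentSet w →
        i ⟨j, Nat.lt_of_succ_lt hj⟩ < i ⟨j + 1, hj⟩} ∧ monomialExponent i = d) ↔
      List.ofFn i = blockIndices 0 ds ∧ BlocksSatisfy IsDescentFree ds w := by
    intro i
    rw [Set.mem_ofPred_eq, and_right_comm, monotone_and_monomialExponent_eq_iff i d N hN]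
    refine and_congr_right fun h => ?_
    have hl : w.length = ds.sum := by
      rw [← length_blockIndices 0 ds, ← h, List.length_ofFn]
    rw [← isChain_zip_blockIndices 0 ds w hl, ← h, List.isChain_iff_getElem]
    constructor
    · intro h' j hj hlt
      simp only [List.length_zip, List.length_ofFn, min_self] at hj
      simp only [List.getElem_zip, List.getElem_ofFn] at hlt ⊢
      exact h' j hj ⟨j, hj, rfl, hlt⟩
    · rintro h' j hj ⟨j', hj', he, hlt⟩
      obtain rfl : j = j' := by omega
      have := h' j (by simpa using hj)
      simp only [List.getElem_zip, List.getElem_ofFn] at this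
      exact this hlt
  change (∑ᶠ κ ∈ {κ | κ ∈ _ ∧ monomialExponent κ = d}, (1 : R)) = _
  simp only [hiff]
  split_ifs with h
  · have : {κ : Fin w.length → ℕ | List.ofFn κ = blockIndices 0 ds ∧
        BlocksSatisfy IsDescentFree ds w} =
        {fun k => (blockIndices 0 ds)[k.1]'(by
          rw [length_blockIndices, hsum, ← h.1]; exact k.2)} := by
      ext κ
      rw [Set.mem_ofPred_eq, Set.mem_singleton_iff, and_iff_left h.2]
      constructor
      · intro hκ
        funext k
        simp [← hκ]
      · rintro rfl
        refine List.ext_getElem ?_ ?_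
        · rw [List.length_ofFn, length_blockIndices, hsum, h.1]
        · intro j _ _
          simp
    rw [this, finsum_mem_singleton]
  · have : {κ : Fin w.length → ℕ | List.ofFn κ = blockIndices 0 ds ∧
        BlocksSatisfy IsDescentFree ds w} = ∅ := by
      rw [Set.eq_empty_iff_forall_notMem]
      rintro κ ⟨h1, h2⟩
      refine h ⟨?_, h2⟩
      rw [← hsum, ← length_blockIndices 0 ds, ← h1, List.length_ofFn]
    rw [this, finsum_mem_empty]

open Classical in
theorem coeff_wordQuasisymmetric {P R : Type*} [PartialOrder P] [CommRing R] (s : Finset (List P))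
    (g : List P → R) (d : ℕ →₀ ℕ) (N : ℕ) (hN : d.support ⊆ Finset.range N) :
    MvPowerSeries.coeff d (wordQuasisymmetric (∑ w ∈ s, Finsupp.single w (g w))) =
      ∑ w ∈ s with w.length = d.degree ∧ BlocksSatisfy IsDescentFree ((List.range N).map d) w,
        g w := by
  have h : wordQuasisymmetric (∑ w ∈ s, Finsupp.single w (g w)) =
      ∑ w ∈ s, g w • fundamentalQuasisymmetric R w.length (descentSet w) := by
    rw [wordQuasisymmetric, ← Finsupp.sum_finsetSum_index]
    · refine Finset.sum_congr rfl fun w _ => ?_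
      exact Finsupp.sum_single_index (zero_smul _ _)
    · exact fun _ => zero_smul _ _
    · exact fun _ _ _ => add_smul _ _ _
  rw [h, map_sum, Finset.sum_filter]
  refine Finset.sum_congr rfl fun w _ => ?_
  rw [MvPowerSeries.coeff_smul, coeff_fundamental_descentSet R w d N hN]
  split_ifs <;> simp

/-! ### Inversions of words -/

section Inversions

variable {P : Type*} [PartialOrder P] (lt : P → P → Prop)

theorem sum_get_eq_countP {α : Type*} (p : α → Prop) [DecidablePred p] (w : List α) :
    (∑ j : Fin w.length, if p (w.get j) then 1 else 0) = w.countP p := by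
  induction w with
  | nil => simp
  | cons a w ih =>
    rw [List.countP_cons, ← ih, add_comm]
    refine (Fin.sum_univ_succ (n := w.length) _).trans ?_
    congr 1
    by_cases h : p a <;> simp [h]

open Classical in
/-- The number of letters of `w` that form an inversion with a preceding letter `a`. -/
noncomputable def inversionsWith (a : P) (w : List P) : ℕ :=
  w.countP fun b => lt b a ∧ IncompOrEq a b

/-- The number of inversions between a letter of `v` and a letter of a subsequent word `w`. -/
noncomputable def crossInversions (v w : List P) : ℕ :=
  (v.map fun a => inversionsWith lt a w).sum

theorem incompInversions_nil : incompInversions lt ([] : List P) = 0 := by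
  rw [incompInversions, Set.ncard_eq_zero]
  rw [Set.eq_empty_iff_forall_notMem]
  rintro ⟨i, _⟩
  exact i.elim0

theorem incompInversions_eq_sum [DecidableRel lt] [DecidableRel (IncompOrEq (P := P))]
    (w : List P) :
    incompInversions lt w = ∑ i : Fin w.length, ∑ j : Fin w.length,
      if i < j ∧ lt (w.get j) (w.get i) ∧ IncompOrEq (w.get i) (w.get j) then 1 else 0 := by
  rw [incompInversions, Set.ncard_eq_toFinset_card', ← Finset.sum_product',
    Finset.univ_product_univ, ← Finset.card_filter]
  congr 1
  ext p
  simp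

theorem incompInversions_cons (a : P) (w : List P) :
    incompInversions lt (a :: w) = inversionsWith lt a w + incompInversions lt w := by
  classical
  rw [incompInversions_eq_sum, incompInversions_eq_sum, inversionsWith, ← sum_get_eq_countP]
  refine (Fin.sum_univ_succ (n := w.length) _).trans ?_
  congr 1
  · refine (Fin.sum_univ_succ (n := w.length) _).trans ?_
    simp
  · refine Finset.sum_congr rfl fun i _ => ?_
    refine (Fin.sum_univ_succ (n := w.length) _).trans ?_
    simp

theorem inversionsWith_append (a : P) (v w : List P) :
    inversionsWith lt a (v ++ w) = inversionsWith lt a v + inversionsWith lt a w :=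
  List.countP_append

theorem crossInversions_append_right (s v w : List P) :
    crossInversions lt s (v ++ w) = crossInversions lt s v + crossInversions lt s w := by
  simp only [crossInversions, inversionsWith_append, List.sum_map_add]

theorem crossInversions_perm (s : List P) {v w : List P} (h : v.Perm w) :
    crossInversions lt s v = crossInversions lt s w := by
  simp only [crossInversions, inversionsWith, h.countP_eq]

theorem incompInversions_append (v w : List P) :
    incompInversions lt (v ++ w) =
      incompInversions lt v + incompInversions lt w + crossInversions lt v w := by
  induction v with
  | nil => simp [incompInversions_nil, crossInversions]
  | cons a v ih =>
    rw [List.cons_append, incompInversions_cons, incompInversions_cons, ih, inversionsWith_append]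
    simp only [crossInversions, List.map_cons, List.sum_cons]
    omega

/-- Interchanging neighbours affects only the pair they form; `¬ lt b a` makes this pair no
inversion in the order `a`, `b`. -/
theorem incompInversions_swap (s t : List P) (a b : P) (hba : ¬ lt b a) :
    (lt a b ∧ IncompOrEq a b → incompInversions lt (s ++ b :: a :: t) =
      incompInversions lt (s ++ a :: b :: t) + 1) ∧
    (¬ (lt a b ∧ IncompOrEq a b) → incompInversions lt (s ++ b :: a :: t) =
      incompInversions lt (s ++ a :: b :: t)) := by
  classical
  have hinc : IncompOrEq b a ↔ IncompOrEq a b := and_comm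
  rw [incompInversions_append, incompInversions_append,
    crossInversions_perm lt s (List.Perm.swap a b t)]
  simp only [incompInversions_cons]
  have h1 : inversionsWith lt b (a :: t) = inversionsWith lt b t +
      if lt a b ∧ IncompOrEq a b then 1 else 0 := by
    simp [inversionsWith, List.countP_cons, hinc]
  have h2 : inversionsWith lt a (b :: t) = inversionsWith lt a t := by
    simp [inversionsWith, hba]
  rw [h1, h2]
  constructor
  · intro h
    rw [if_pos h]
    omega
  · intro h
    rw [if_neg h]
    omega

theorem incompInversions_eq_zero {w : List P} (h : IsDecreasingWord w) :
    incompInversions lt w = 0 := by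
  rw [isDecreasingWord_iff_pairwise] at h
  induction w with
  | nil => exact incompInversions_nil lt
  | cons a w ih =>
    rw [List.pairwise_cons] at h
    rw [incompInversions_cons, ih h.2, inversionsWith, add_zero, List.countP_eq_zero]
    intro b hb
    simpa using fun _ hi => absurd (h.1 b hb) hi.2

theorem crossInversions_flatten (v : List P) {N : ℕ} (D : Fin N → List P) :
    crossInversions lt v (List.ofFn D).flatten = ∑ i, crossInversions lt v (D i) := by
  induction N with
  | zero => simp [crossInversions, inversionsWith]
  | succ N ih =>
    rw [List.ofFn_succ, List.flatten_cons, crossInversions_append_right, Fin.sum_univ_succ,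
      ih fun i => D i.succ]

/-- For decreasing blocks the first sum vanishes, which leaves the inversions between different
blocks, to be matched with ascents. -/
theorem incompInversions_flatten {N : ℕ} (D : Fin N → List P) :
    incompInversions lt (List.ofFn D).flatten =
      ∑ i, incompInversions lt (D i) +
        ∑ i, ∑ j, if i < j then crossInversions lt (D i) (D j) else 0 := by
  induction N with
  | zero => simp [incompInversions_nil]
  | succ N ih =>
    rw [List.ofFn_succ, List.flatten_cons, incompInversions_append, ih fun i => D i.succ,
      crossInversions_flatten]
    simp only [Fin.sum_univ_succ, Fin.succ_lt_succ_iff, Fin.succ_pos, if_true, if_false,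
      Fin.not_lt_zero, zero_add]
    omega

end Inversions

/-! ### Colorings and tuples of decreasing words -/

/-- A way to arrange finite sets as words that arranges chains decreasingly. -/
structure IsArrangement {P : Type*} [PartialOrder P] (srt : Finset P → List P) : Prop where
  nodup : ∀ C, (srt C).Nodup
  mem : ∀ C a, a ∈ srt C ↔ a ∈ C
  chain : ∀ C : Finset P, (∀ a ∈ C, ∀ b ∈ C, a ≠ b → a < b ∨ b < a) → IsDecreasingWord (srt C)

/-- Sets are sorted along a linear extension of the reversed order. -/
theorem exists_isArrangement (P : Type*) [PartialOrder P] :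
    ∃ srt : Finset P → List P, IsArrangement srt := by
  classical
  obtain ⟨s, hs, hle⟩ := extend_partialOrder (fun a b : P => b ≤ a)
  refine ⟨fun C => C.sort s, fun C => Finset.sort_nodup _ _, fun C a => Finset.mem_sort _, ?_⟩
  intro C hC
  rw [isDecreasingWord_iff_pairwise]
  have h1 : (C.sort s).Pairwise s := Finset.pairwise_sort _ _
  have h2 : (C.sort s).Pairwise (· ≠ ·) := Finset.sort_nodup C s
  refine (h1.and h2).imp_of_mem fun {a b} ha hb h => ?_
  rw [Finset.mem_sort] at ha hb
  rcases hC a ha b hb h.2 with h' | h'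
  · exact absurd (antisymm (r := s) h.1 (hle _ _ h'.le)) h.2
  · exact h'

theorem monomialExponent_eq_card {V : Type*} [Fintype V] (κ : V → ℕ) (j : ℕ) :
    monomialExponent κ j = (Finset.univ.filter fun v => κ v = j).card := by
  rw [monomialExponent, Finsupp.finsetSum_apply, Finset.card_filter]
  exact Finset.sum_congr rfl fun v _ => Finsupp.single_apply

theorem lt_of_monomialExponent_eq {V : Type*} [Fintype V] {κ : V → ℕ} {N : ℕ} {d : ℕ →₀ ℕ}
    (hN : d.support ⊆ Finset.range N) (h : monomialExponent κ = d) (x : V) : κ x < N := by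
  refine Finset.mem_range.1 (hN ?_)
  rw [Finsupp.mem_support_iff, ← h, monomialExponent_eq_card]
  exact Finset.card_ne_zero_of_mem (Finset.mem_filter.2 ⟨Finset.mem_univ x, rfl⟩)

theorem count_flatten_ofFn {P : Type*} [DecidableEq P] {N : ℕ} (D : Fin N → List P) (a : P) :
    (List.ofFn D).flatten.count a = ∑ i, (D i).count a := by
  rw [List.count_flatten, List.map_ofFn, List.sum_ofFn]
  rfl

theorem decreasingWord_ext {P : Type*} [PartialOrder P] {v w : List P} (hv : IsDecreasingWord v) (hw : IsDecreasingWord w)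
    (h : ∀ a, a ∈ v ↔ a ∈ w) : v = w := by
  rw [isDecreasingWord_iff_pairwise] at hv hw
  refine List.Perm.eq_of_pairwise (le := fun a b => b < a)
    (fun a b _ _ h h' => absurd h' h.asymm) hv hw ?_
  exact (List.perm_ext_iff_of_nodup (hv.imp fun h => h.ne') (hw.imp fun h => h.ne')).2 h

theorem IsDecreasingWord.nodup {P : Type*} [PartialOrder P] {w : List P} (h : IsDecreasingWord w) : w.Nodup :=
  (isDecreasingWord_iff_pairwise.1 h).imp fun h => h.ne'

/-- The letters of the elements of `P[β]` of a given color. -/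
def colorLetters {P : Type*} [DecidableEq P] [Fintype P] {β : Multiset P} (κ : Blowup β → ℕ) (k : ℕ) : Finset P :=
  (Finset.univ.filter fun x => κ x = k).image fun x : Blowup β => x.1

theorem mem_colorLetters {P : Type*} [DecidableEq P] [Fintype P] {β : Multiset P} {κ : Blowup β → ℕ} {k : ℕ} {a : P} :
    a ∈ colorLetters κ k ↔ ∃ i, κ ⟨a, i⟩ = k := by
  simp only [colorLetters, Finset.mem_image, Finset.mem_filter, Finset.mem_univ, true_and]
  constructor
  · rintro ⟨⟨a, i⟩, h, rfl⟩
    exact ⟨i, h⟩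
  · rintro ⟨i, h⟩
    exact ⟨⟨a, i⟩, h, rfl⟩

section Colorings

variable {P : Type*} [DecidableEq P] [PartialOrder P] {β : Multiset P}

theorem multicolorings_injective {κ : Blowup β → ℕ} (hκ : κ ∈ multicolorings β) {x y : Blowup β}
    (h1 : κ x = κ y) (h2 : x.1 = y.1) : x = y := by
  obtain ⟨a, i⟩ := x
  obtain ⟨b, j⟩ := y
  obtain rfl : a = b := h2
  rcases lt_trichotomy i j with h | rfl | h
  · exact absurd h1 (hκ.2 a i j h).ne'
  · rfl
  · exact absurd h1 (hκ.2 a j i h).ne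

theorem incompGraph_blowup_adj {x y : Blowup β} :
    (incompGraph (Blowup β)).Adj x y ↔ x ≠ y ∧ ¬ x.1 < y.1 ∧ ¬ y.1 < x.1 := by
  change (¬ (x = y ∨ x.1 < y.1) ∧ ¬ (y = x ∨ y.1 < x.1)) ↔ _
  rw [eq_comm (a := y)]
  tauto

theorem multicolorings_comparable {κ : Blowup β → ℕ} (hκ : κ ∈ multicolorings β) {x y : Blowup β}
    (h1 : κ x = κ y) (h2 : x.1 ≠ y.1) : x.1 < y.1 ∨ y.1 < x.1 := by
  by_contra h
  rw [not_or] at h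
  exact hκ.1 x y (incompGraph_blowup_adj.2 ⟨fun he => h2 (he ▸ rfl), h⟩) h1

variable [Fintype P]

theorem sum_colorLetters {M : Type*} [AddCommMonoid M] {κ : Blowup β → ℕ}
    (hκ : κ ∈ multicolorings β) (k : ℕ) (F : P → M) :
    ∑ a ∈ colorLetters κ k, F a = ∑ x with κ x = k, F x.1 := by
  refine Finset.sum_image fun x hx y hy h => ?_
  simp only [Finset.mem_coe, Finset.mem_filter, Finset.mem_univ, true_and] at hx hy
  exact multicolorings_injective hκ (hx.trans hy.symm) h

theorem card_colorLetters {κ : Blowup β → ℕ} (hκ : κ ∈ multicolorings β) (k : ℕ) :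
    (colorLetters κ k).card = monomialExponent κ k := by
  rw [monomialExponent_eq_card, Finset.card_eq_sum_ones, sum_colorLetters hκ,
    ← Finset.card_eq_sum_ones]

theorem colorLetters_chain {κ : Blowup β → ℕ} (hκ : κ ∈ multicolorings β) (k : ℕ) :
    ∀ a ∈ colorLetters κ k, ∀ b ∈ colorLetters κ k, a ≠ b → a < b ∨ b < a := by
  intro a ha b hb hab
  obtain ⟨i, hi⟩ := mem_colorLetters.1 ha
  obtain ⟨j, hj⟩ := mem_colorLetters.1 hb
  exact multicolorings_comparable hκ (hi.trans hj.symm) hab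

/-- The colors decrease along the copies of `a`, so they are determined by the set of colors that
`a` receives. -/
theorem multicolorings_ext {κ κ' : Blowup β → ℕ} (hκ : κ ∈ multicolorings β)
    (hκ' : κ' ∈ multicolorings β) (h : ∀ k, colorLetters κ k = colorLetters κ' k) : κ = κ' := by
  have key : ∀ a, (fun i : Fin (β.count a) => κ ⟨a, i.rev⟩) = fun i => κ' ⟨a, i.rev⟩ := by
    intro a
    refine (StrictMono.range_inj ?_ ?_).1 ?_
    · exact fun i j hij => hκ.2 a _ _ (Fin.rev_lt_rev.2 hij)
    · exact fun i j hij => hκ'.2 a _ _ (Fin.rev_lt_rev.2 hij)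
    · have : ∀ κ : Blowup β → ℕ, Set.range (fun i : Fin (β.count a) => κ ⟨a, i.rev⟩) =
          {k | a ∈ colorLetters κ k} := by
        intro κ
        ext k
        rw [Set.mem_ofPred_eq, mem_colorLetters, Set.mem_range]
        exact Fin.revPerm.exists_congr_left.trans (by simp)
      rw [this, this]
      simp only [h]
  funext ⟨a, i⟩
  have := congrFun (key a) i.rev
  simpa using this

theorem card_colors {κ : Blowup β → ℕ} (hκ : κ ∈ multicolorings β) {N : ℕ} (hN : ∀ x, κ x < N)
    (a : P) : (∑ i : Fin N, if a ∈ colorLetters κ i.rev then 1 else 0) = β.count a := by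
  have h : (Finset.univ.filter fun i : Fin N => a ∈ colorLetters κ i.rev) =
      Finset.univ.image fun j : Fin (β.count a) => (⟨κ ⟨a, j⟩, hN _⟩ : Fin N).rev := by
    ext i
    simp only [Finset.mem_filter, Finset.mem_univ, true_and, Finset.mem_image, mem_colorLetters]
    refine exists_congr fun j => ?_
    rw [Fin.rev_eq_iff, Fin.ext_iff]
  rw [← Finset.card_filter, h, Finset.card_image_of_injective, Finset.card_univ, Fintype.card_fin]
  intro j j' hj
  have h1 := congrArg Fin.val (Fin.rev_injective hj)
  exact eq_of_heq (Sigma.mk.inj (multicolorings_injective hκ (x := ⟨a, j⟩) (y := ⟨a, j'⟩) h1 rfl)).2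

/-- Every tuple of decreasing words of total content `β` comes from a multicoloring. -/
theorem exists_multicoloring {N : ℕ} (D : Fin N → List P) (hD : ∀ i, IsDecreasingWord (D i))
    (hβ : ((List.ofFn D).flatten : Multiset P) = β) :
    ∃ κ ∈ multicolorings β, (∀ x, κ x < N) ∧
      ∀ (i : Fin N) (a : P), a ∈ colorLetters κ i.rev ↔ a ∈ D i := by
  -- `K a` is the set of colors that the copies of `a` must receive; `κ` below hands them out in
  -- decreasing order.
  let K : P → Finset ℕ := fun a => (Finset.univ.filter fun i => a ∈ D i).image fun i => (i.rev : ℕ)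
  have hinj : Function.Injective fun i : Fin N => (i.rev : ℕ) :=
    Fin.val_injective.comp Fin.rev_injective
  have hK : ∀ a, (K a).card = β.count a := by
    intro a
    rw [Finset.card_image_of_injective _ hinj, Finset.card_filter, ← hβ, Multiset.coe_count,
      count_flatten_ofFn]
    refine Finset.sum_congr rfl fun i _ => ?_
    rw [(hD i).nodup.count]
  have hmem : ∀ a (i : Fin N), (i.rev : ℕ) ∈ K a ↔ a ∈ D i := by
    intro a i
    rw [Finset.mem_image]
    constructor
    · rintro ⟨j, hj, h⟩
      rw [← hinj h]
      simpa using hj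
    · exact fun h => ⟨i, by simpa using h, rfl⟩
  let κ : Blowup β → ℕ := fun x => (K x.1).orderEmbOfFin (hK x.1) x.2.rev
  have hκK : ∀ x, κ x ∈ K x.1 := fun x => Finset.orderEmbOfFin_mem _ _ _
  have hlt : ∀ (a : P) (i j : Fin (β.count a)), i < j → κ ⟨a, j⟩ < κ ⟨a, i⟩ := by
    intro a i j hij
    exact ((K a).orderEmbOfFin (hK a)).strictMono (Fin.rev_lt_rev.2 hij)
  refine ⟨κ, ⟨fun x y hxy he => ?_, hlt⟩, fun x => ?_, fun i a => ?_⟩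
  · rw [incompGraph_blowup_adj] at hxy
    obtain ⟨i, hi, hix⟩ := Finset.mem_image.1 (hκK x)
    have hx : x.1 ∈ D i := (hmem _ _).1 (hix ▸ hκK x)
    have hy : y.1 ∈ D i := (hmem _ _).1 ((hix.trans he) ▸ hκK y)
    by_cases h : x.1 = y.1
    · obtain ⟨a, j⟩ := x
      obtain ⟨b, j'⟩ := y
      obtain rfl : a = b := h
      rcases lt_trichotomy j j' with h | rfl | h
      · exact (hlt a j j' h).ne' he
      · exact hxy.1 rfl
      · exact (hlt a j' j h).ne he
    · have h1 := (isDecreasingWord_iff_pairwise.1 (hD i)).imp (S := fun a b => a < b ∨ b < a)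
        fun h => Or.inr h
      have : Std.Symm fun a b : P => a < b ∨ b < a := ⟨fun a b h => h.symm⟩
      exact (h1.forall hx hy h).elim hxy.2.1 hxy.2.2
  · obtain ⟨i, -, h⟩ := Finset.mem_image.1 (hκK x)
    rw [← h]
    exact i.rev.2
  · rw [← hmem, mem_colorLetters]
    constructor
    · rintro ⟨j, h⟩
      exact h ▸ hκK ⟨a, j⟩
    · intro h
      have h1 : (i.rev : ℕ) ∈ Set.range ((K a).orderEmbOfFin (hK a)) := by
        rw [Finset.range_orderEmbOfFin]
        exact h
      obtain ⟨j, hj⟩ := h1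
      refine ⟨j.rev, ?_⟩
      change (K a).orderEmbOfFin (hK a) j.rev.rev = _
      rw [Fin.rev_rev, hj]

/-- Multicolorings with colors below `N` correspond to tuples of decreasing words. -/
theorem bijOn_multicolorings {srt : Finset P → List P} (hs : IsArrangement srt) (d : ℕ →₀ ℕ) (N : ℕ) (hN : d.support ⊆ Finset.range N) :
    Set.BijOn (fun (κ : Blowup β → ℕ) (i : Fin N) => srt (colorLetters κ i.rev))
      {κ | κ ∈ multicolorings β ∧ monomialExponent κ = d}
      {D | (∀ i, IsDecreasingWord (D i) ∧ (D i).length = d i.rev) ∧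
        ((List.ofFn D).flatten : Multiset P) = β} := by
  obtain ⟨hnd, hmem, hchain⟩ := hs
  have hlen : ∀ C, (srt C).length = C.card := by
    intro C
    rw [← List.toFinset_card_of_nodup (hnd C)]
    congr 1
    ext a
    rw [List.mem_toFinset, hmem]
  refine ⟨?_, ?_, ?_⟩
  · rintro κ ⟨hκ, hd⟩
    refine ⟨fun i => ⟨hchain _ (colorLetters_chain hκ _), ?_⟩, ?_⟩
    · rw [hlen, card_colorLetters hκ, hd]
    · ext a
      rw [Multiset.coe_count, count_flatten_ofFn,
        ← card_colors hκ (lt_of_monomialExponent_eq hN hd)]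
      refine Finset.sum_congr rfl fun i _ => ?_
      rw [(hnd _).count]
      simp only [hmem]
  · rintro κ ⟨hκ, hd⟩ κ' ⟨hκ', hd'⟩ h
    refine multicolorings_ext hκ hκ' fun k => ?_
    have hlt := lt_of_monomialExponent_eq hN hd
    have hlt' := lt_of_monomialExponent_eq hN hd'
    ext a
    by_cases hk : k < N
    · have := congrFun h (Fin.rev ⟨k, hk⟩)
      simp only [Fin.rev_rev] at this
      rw [← hmem, this, hmem]
    · rw [mem_colorLetters, mem_colorLetters]
      constructor
      · rintro ⟨i, rfl⟩
        exact absurd (hlt _) hk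
      · rintro ⟨i, rfl⟩
        exact absurd (hlt' _) hk
  · rintro D ⟨hD, hβ⟩
    obtain ⟨κ, hκ, hlt, hκD⟩ := exists_multicoloring D (fun i => (hD i).1) hβ
    have hD' : (fun i : Fin N => srt (colorLetters κ i.rev)) = D := by
      funext i
      refine decreasingWord_ext (hchain _ (colorLetters_chain hκ _)) (hD i).1 fun a => ?_
      rw [hmem, hκD]
    refine ⟨κ, ⟨hκ, ?_⟩, hD'⟩
    ext k
    by_cases hk : k < N
    · have h1 := (hD (Fin.rev ⟨k, hk⟩)).2
      rw [← congrFun hD' (Fin.rev ⟨k, hk⟩)] at h1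
      simp only [Fin.rev_rev] at h1
      rw [← h1, hlen, card_colorLetters hκ]
    · rw [Finsupp.notMem_support_iff.1 fun h => hk (Finset.mem_range.1 (hN h)),
        monomialExponent_eq_card, Finset.card_eq_zero, Finset.filter_eq_empty_iff]
      rintro x - rfl
      exact hk (hlt x)

theorem sum_blowup_eq {κ : Blowup β → ℕ} (hκ : κ ∈ multicolorings β) {N : ℕ} (hN : ∀ x, κ x < N)
    (F : ℕ → P → ℕ) :
    ∑ x, F (κ x) x.1 = ∑ i : Fin N, ∑ a ∈ colorLetters κ i.rev, F i.rev a := by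
  rw [← Finset.sum_fiberwise Finset.univ fun x => (⟨κ x, hN x⟩ : Fin N).rev]
  refine Finset.sum_congr rfl fun i _ => ?_
  rw [sum_colorLetters hκ]
  refine Finset.sum_congr ?_ fun x hx => ?_
  · ext x
    simp only [Finset.mem_filter, Finset.mem_univ, true_and]
    rw [Fin.rev_eq_iff, Fin.ext_iff]
  · simp only [Finset.mem_filter, Finset.mem_univ, true_and] at hx
    rw [hx]

/-- Color classes are concatenated from the largest color to the smallest. So for incomparable
letters, a smaller letter with a smaller color stands to the right of the larger letter: ascents
become inversions. Inside a class there are none, as it is a chain. -/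
theorem ascents_eq_incompInversions (lt : P → P → Prop) {srt : Finset P → List P}
    (hs : IsArrangement srt) {κ : Blowup β → ℕ} (hκ : κ ∈ multicolorings β) {N : ℕ} (hN : ∀ x, κ x < N) :
    ascents (Blowup.totalLT lt β) κ = incompInversions lt
      (List.ofFn fun i : Fin N => srt (colorLetters κ i.rev)).flatten := by
  classical
  obtain ⟨hnd, hmem, hchain⟩ := hs
  have h1 : ascents (Blowup.totalLT lt β) κ = ∑ x : Blowup β, ∑ y : Blowup β,
      if lt x.1 y.1 ∧ IncompOrEq x.1 y.1 ∧ κ x < κ y then 1 else 0 := by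
    rw [ascents, Set.ncard_eq_toFinset_card', ← Finset.sum_product', Finset.univ_product_univ,
      ← Finset.card_filter]
    congr 1
    ext ⟨x, y⟩
    simp only [Set.mem_toFinset, Set.mem_ofPred_eq, Finset.mem_filter, Finset.mem_univ, true_and]
    refine ⟨fun ⟨h1, h2, h3⟩ => ⟨?_, h2, h3⟩, fun ⟨h1, h2, h3⟩ => ⟨?_, h2, h3⟩⟩
    -- Two copies of one element never form an ascent, because `κ` decreases along the copies.
    · rcases h1 with ⟨_, _, h⟩ | ⟨_, _, h⟩
      · exact h
      · exact absurd h3 (hκ.2 _ _ _ h).not_gt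
    · obtain ⟨a, i⟩ := x
      obtain ⟨b, j⟩ := y
      exact Sigma.Lex.left _ _ h1
  have h2 : ∀ v C, crossInversions lt (srt v) (srt C) =
      ∑ b ∈ v, ∑ a ∈ C, if lt a b ∧ IncompOrEq a b then 1 else 0 := by
    intro v C
    have hC : ∀ C, (srt C).toFinset = C := fun C => by
      ext a
      rw [List.mem_toFinset, hmem]
    rw [crossInversions, ← List.sum_toFinset _ (hnd v), hC]
    refine Finset.sum_congr rfl fun b _ => ?_
    rw [inversionsWith, List.countP_eq_length_filter,
      ← List.toFinset_card_of_nodup ((hnd C).filter _), List.toFinset_filter, hC,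
      ← Finset.card_filter]
    congr 1
    ext a
    simp only [Finset.mem_filter, decide_eq_true_eq]
    rw [show IncompOrEq b a ↔ IncompOrEq a b from and_comm]
  rw [h1, incompInversions_flatten, Finset.sum_eq_zero fun i _ =>
    incompInversions_eq_zero lt (hchain _ (colorLetters_chain hκ _)), zero_add]
  rw [Finset.sum_congr rfl fun x _ => sum_blowup_eq hκ hN fun k b =>
    if lt x.1 b ∧ IncompOrEq x.1 b ∧ κ x < k then 1 else 0]
  rw [sum_blowup_eq hκ hN fun k a => ∑ i : Fin N, ∑ b ∈ colorLetters κ i.rev,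
    if lt a b ∧ IncompOrEq a b ∧ k < i.rev then 1 else 0]
  conv_rhs => rw [Finset.sum_comm]
  refine Finset.sum_congr rfl fun j _ => ?_
  rw [Finset.sum_comm]
  refine Finset.sum_congr rfl fun i _ => ?_
  rw [Finset.sum_comm, h2]
  have h3 : (j.rev : ℕ) < i.rev ↔ i < j := Fin.rev_lt_rev
  simp only [h3]
  split_ifs with hij <;> simp [hij]

end Colorings

/-! ### Commuting elementary functions -/

theorem commute_wordSum {P B : Type*} [Fintype P] [Ring B] (u : P → B)
    (h : ∀ a b, Commute (u a) (u b)) (i j : ℕ) (p q : List P → Prop) :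
    Commute (wordSum u i p) (wordSum u j q) := by
  classical
  refine Commute.sum_left _ _ _ fun v _ => Commute.sum_right _ _ _ fun w _ => ?_
  refine Commute.list_prod_left _ _ fun x hx => Commute.list_prod_right _ _ fun y hy => ?_
  obtain ⟨a, -, rfl⟩ := List.mem_map.1 hx
  obtain ⟨b, -, rfl⟩ := List.mem_map.1 hy
  exact h a b

/-! ### Natural unit interval orders, numbered by rank. -/

namespace IsNaturalUnitIntervalOrder

variable {P : Type*} [PartialOrder P] {lt : P → P → Prop}

theorem asymm (H : IsNaturalUnitIntervalOrder P lt) {a b : P} (h : lt a b) : ¬ lt b a := by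
  have := H.total
  exact fun h' => irrefl (r := lt) a (_root_.trans h h')

theorem trichotomy (H : IsNaturalUnitIntervalOrder P lt) (a b : P) : lt a b ∨ a = b ∨ lt b a := by
  have := H.total
  exact trichotomous_of lt a b

theorem incompRel {a b : P} (hne : a ≠ b) (h1 : ¬ a < b) (h2 : ¬ b < a) :
    IncompRel (· ≤ ·) a b :=
  ⟨fun h => h1 (h.lt_of_ne hne), fun h => h2 (h.lt_of_ne hne.symm)⟩

/-- Otherwise `a` would be incomparable to both `b` and `c`, and `between` would place `a` after
`b`. -/
theorem lt_of_lt_left (H : IsNaturalUnitIntervalOrder P lt) {a b c : P} (h1 : lt a b)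
    (h2 : b < c) : a < c := by
  have ht := H.total
  have hac : lt a c := _root_.trans h1 (H.lt_of_lt _ _ h2)
  by_contra h3
  have hca : ¬ c < a := fun h => H.asymm hac (H.lt_of_lt _ _ h)
  have hne : c ≠ a := by
    rintro rfl
    exact H.asymm hac hac
  by_cases h4 : a < b
  · exact h3 (h4.trans h2)
  · have hba : ¬ b < a := fun h => H.asymm h1 (H.lt_of_lt _ _ h)
    have hne' : b ≠ a := by
      rintro rfl
      exact H.asymm h1 h1
    exact H.asymm h1 (H.between b a c h2 (incompRel hne' hba h4) (incompRel hne.symm h3 hca)).1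

theorem lt_of_lt_right (H : IsNaturalUnitIntervalOrder P lt) {a b c : P} (h1 : a < b)
    (h2 : lt b c) : a < c := by
  have ht := H.total
  have hac : lt a c := _root_.trans (H.lt_of_lt _ _ h1) h2
  by_contra h3
  have hca : ¬ c < a := fun h => H.asymm hac (H.lt_of_lt _ _ h)
  have hne : a ≠ c := by
    rintro rfl
    exact H.asymm hac hac
  by_cases h4 : b < c
  · exact h3 (h1.trans h4)
  · have hcb : ¬ c < b := fun h => H.asymm h2 (H.lt_of_lt _ _ h)
    have hne' : c ≠ b := by
      rintro rfl
      exact H.asymm h2 h2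
    exact H.asymm h2 (H.between a c b h1 (incompRel hne h3 hca) (incompRel hne' hcb h4)).2

open Classical in
/-- The number of elements before `a` in the total order. -/
noncomputable def rank [Fintype P] (lt : P → P → Prop) (a : P) : ℕ :=
  (Finset.univ.filter fun b => lt b a).card

theorem rank_lt_rank [Fintype P] (H : IsNaturalUnitIntervalOrder P lt) {a b : P} (h : lt a b) :
    rank lt a < rank lt b := by
  classical
  have ht := H.total
  refine Finset.card_lt_card (Finset.ssubset_iff_subset_ne.2 ⟨fun x hx => ?_, fun he => ?_⟩)
  · simp only [Finset.mem_filter, Finset.mem_univ, true_and] at hx ⊢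
    exact _root_.trans hx h
  · have : a ∈ Finset.univ.filter fun x => lt x a := by
      rw [he]
      simpa using h
    simp only [Finset.mem_filter, Finset.mem_univ, true_and] at this
    exact H.asymm this this

theorem rank_lt_iff [Fintype P] (H : IsNaturalUnitIntervalOrder P lt) {a b : P} :
    rank lt a < rank lt b ↔ lt a b := by
  refine ⟨fun h => ?_, H.rank_lt_rank⟩
  rcases H.trichotomy a b with h' | rfl | h'
  · exact h'
  · exact absurd h (lt_irrefl _)
  · exact absurd h (H.rank_lt_rank h').asymm

theorem rank_injective [Fintype P] (H : IsNaturalUnitIntervalOrder P lt) :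
    Function.Injective (rank lt) := by
  intro a b h
  rcases H.trichotomy a b with h' | h' | h'
  · exact absurd h (H.rank_lt_rank h').ne
  · exact h'
  · exact absurd h (H.rank_lt_rank h').ne'

theorem rank_lt_card [Fintype P] (H : IsNaturalUnitIntervalOrder P lt) (a : P) :
    rank lt a < Fintype.card P := by
  classical
  refine Finset.card_lt_univ_of_notMem (x := a) fun h => ?_
  simp only [Finset.mem_filter, Finset.mem_univ, true_and] at h
  exact H.asymm h h

theorem exists_rank_eq [Fintype P] (H : IsNaturalUnitIntervalOrder P lt) {n : ℕ}
    (hn : n < Fintype.card P) : ∃ a, rank lt a = n := by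
  let F : P → Fin (Fintype.card P) := fun a => ⟨rank lt a, H.rank_lt_card a⟩
  have hF : Function.Bijective F := by
    rw [Fintype.bijective_iff_injective_and_card]
    exact ⟨fun a b h => H.rank_injective (congrArg Fin.val h), by simp⟩
  obtain ⟨a, ha⟩ := hF.2 ⟨n, hn⟩
  exact ⟨a, congrArg Fin.val ha⟩

open Classical in
/-- The number of elements that are smaller than `a` in the partial order. -/
noncomputable def lowerCard [Fintype P] (a : P) : ℕ := (Finset.univ.filter fun b => b < a).card

/-- By `lt_of_lt_left` the elements below `a` form an initial segment of the total order, so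
`lowerCard` plays the role of `f` in `IsUnitIntervalElementary`. -/
theorem rank_lt_lowerCard_iff [Fintype P] (H : IsNaturalUnitIntervalOrder P lt) {a b : P} :
    rank lt b < lowerCard a ↔ b < a := by
  classical
  constructor
  · intro h
    by_contra hba
    refine absurd (Finset.card_le_card fun x hx => ?_) h.not_ge
    simp only [Finset.mem_filter, Finset.mem_univ, true_and] at hx ⊢
    rcases H.trichotomy x b with h' | rfl | h'
    · exact h'
    · exact absurd hx hba
    · exact absurd (H.lt_of_lt_left h' hx) hba
  · intro h
    refine Finset.card_lt_card (Finset.ssubset_iff_subset_ne.2 ⟨fun x hx => ?_, fun he => ?_⟩)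
    · simp only [Finset.mem_filter, Finset.mem_univ, true_and] at hx ⊢
      exact H.lt_of_lt_left hx h
    · have : b ∈ Finset.univ.filter fun x => lt x b := by
        rw [he]
        simpa using h
      simp only [Finset.mem_filter, Finset.mem_univ, true_and] at this
      exact H.asymm this this

theorem lowerCard_le_rank [Fintype P] (H : IsNaturalUnitIntervalOrder P lt) (a : P) :
    lowerCard a ≤ rank lt a := by
  classical
  refine Finset.card_le_card fun x hx => ?_
  simp only [Finset.mem_filter, Finset.mem_univ, true_and] at hx ⊢
  exact H.lt_of_lt _ _ hx

theorem lowerCard_mono [Fintype P] (H : IsNaturalUnitIntervalOrder P lt) {a b : P}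
    (h : rank lt a ≤ rank lt b) : lowerCard a ≤ lowerCard b := by
  classical
  rcases h.lt_or_eq with h | h
  · refine Finset.card_le_card fun x hx => ?_
    simp only [Finset.mem_filter, Finset.mem_univ, true_and] at hx ⊢
    exact H.lt_of_lt_right hx (H.rank_lt_iff.1 h)
  · rw [H.rank_injective h]

/-- The elementary functions of a natural unit interval order in variables that commute or
`q`-commute do commute. -/
theorem commute_ncElem [Fintype P] (H : IsNaturalUnitIntervalOrder P lt) {R B : Type*} [CommRing R]
    [Ring B] [Algebra R B] (q : R) (u : P → B) (hcomm : ∀ a b, a < b → u a * u b = u b * u a)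
    (hq : ∀ a b, lt a b → IncompOrEq a b → u a * u b = q • (u b * u a)) (i j : ℕ) :
    ncElem u i * ncElem u j = ncElem u j * ncElem u i := by
  classical
  -- Numbers that are not ranks get the variable `0` and `f n = n`. This keeps `f` monotone, makes
  -- the relations trivial there, and lets `A` stay constant from `Fintype.card P` on.
  let v : ℕ → B := fun n => if h : ∃ a, rank lt a = n then u h.choose else 0
  let f : ℕ → ℕ := fun n => if h : ∃ a : P, rank lt a = n then lowerCard h.choose else n
  let A : ℕ → ℕ → B := fun n k =>
    wordSum u k fun w => IsDecreasingWord w ∧ ∀ x ∈ w, rank lt x < n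
  have hchoose : ∀ (a : P) (h : ∃ b, rank lt b = rank lt a), h.choose = a := fun a h =>
    H.rank_injective h.choose_spec
  have hv : ∀ a, v (rank lt a) = u a := by
    intro a
    have h : ∃ b, rank lt b = rank lt a := ⟨a, rfl⟩
    simp only [v, dif_pos h, hchoose a h]
  have hf : ∀ a, f (rank lt a) = lowerCard a := by
    intro a
    have h : ∃ b, rank lt b = rank lt a := ⟨a, rfl⟩
    simp only [f, dif_pos h, hchoose a h]
  have hv' : ∀ n, (¬ ∃ a, rank lt a = n) → v n = 0 := fun n h => dif_neg h
  have hf' : ∀ n, (¬ ∃ a, rank lt a = n) → f n = n := fun n h => dif_neg h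
  have hle : ∀ n, f n ≤ n := by
    intro n
    by_cases h : ∃ a, rank lt a = n
    · obtain ⟨a, rfl⟩ := h
      rw [hf]
      exact H.lowerCard_le_rank a
    · exact (hf' n h).le
  have key : IsUnitIntervalElementary q f v A := by
    refine ⟨?_, hle, ?_, ?_, ?_, ?_, ?_⟩
    · intro n m hnm
      by_cases hm : ∃ a, rank lt a = m
      · have hn : ∃ a, rank lt a = n := by
          obtain ⟨a, rfl⟩ := hm
          exact H.exists_rank_eq (lt_of_le_of_lt hnm (H.rank_lt_card a))
        obtain ⟨a, rfl⟩ := hm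
        obtain ⟨b, rfl⟩ := hn
        rw [hf, hf]
        exact H.lowerCard_mono hnm
      · rw [hf' m hm]
        exact (hle n).trans hnm
    · intro n k hk
      by_cases hn : ∃ a, rank lt a = n
      · obtain ⟨a, rfl⟩ := hn
        obtain ⟨b, rfl⟩ := H.exists_rank_eq
          (lt_of_lt_of_le (lt_of_lt_of_le hk (hle _)) (H.rank_lt_card a).le)
        rw [hf] at hk
        rw [hv, hv]
        exact hcomm b a (H.rank_lt_lowerCard_iff.1 hk)
      · rw [hv' n hn, mul_zero, zero_mul]
    · intro n k hk hkn
      by_cases hn : ∃ a, rank lt a = n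
      · obtain ⟨a, rfl⟩ := hn
        obtain ⟨b, rfl⟩ := H.exists_rank_eq (hkn.trans (H.rank_lt_card a))
        rw [hf] at hk
        rw [hv, hv]
        have hlt := H.rank_lt_iff.1 hkn
        refine hq b a hlt ⟨fun h => ?_, fun h => H.asymm hlt (H.lt_of_lt _ _ h)⟩
        exact absurd (H.rank_lt_lowerCard_iff.2 h) hk.not_gt
      · rw [hv' n hn, mul_zero, zero_mul, smul_zero]
    · intro n
      exact wordSum_zero u _ ⟨List.isChain_nil, by simp⟩
    · intro k
      refine wordSum_eq_zero u _ fun w hw h => ?_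
      obtain ⟨a, w, rfl⟩ := List.exists_cons_of_length_eq_add_one hw
      exact Nat.not_lt_zero _ (h.2 a List.mem_cons_self)
    · intro n k
      by_cases hn : ∃ a, rank lt a = n
      · obtain ⟨a, rfl⟩ := hn
        have h := wordSum_decreasing_insert u k (fun x => rank lt x < rank lt a) a (lt_irrefl _)
          fun x hx h => hx.asymm (H.rank_lt_rank (H.lt_of_lt _ _ h))
        rw [hv, hf]
        refine Eq.trans (wordSum_congr u _ fun w _ => ?_) (h.trans ?_)
        · refine and_congr_right fun _ => forall₂_congr fun x _ => ?_
          rw [Nat.lt_succ_iff_lt_or_eq, or_comm]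
          exact or_congr_left ⟨fun h => H.rank_injective h, fun h => h ▸ rfl⟩
        · congr 2
          refine wordSum_congr u _ fun w _ => ?_
          refine and_congr_right fun _ => forall₂_congr fun x _ => ?_
          rw [H.rank_lt_lowerCard_iff]
          exact and_iff_right_of_imp fun h => H.rank_lt_rank (H.lt_of_lt _ _ h)
      · rw [hv' n hn, zero_mul, add_zero]
        refine wordSum_congr u _ fun w _ => ?_
        refine and_congr_right fun _ => forall₂_congr fun x _ => ?_
        rw [Nat.lt_succ_iff_lt_or_eq]
        exact or_iff_left fun h => hn ⟨x, h⟩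
  have hA : ∀ k, ncElem u k = A (Fintype.card P) k := fun k =>
    wordSum_congr u _ fun w _ => (and_iff_left fun x _ => H.rank_lt_card x).symm
  rw [hA, hA]
  exact key.commute _ _ _

end IsNaturalUnitIntervalOrder

/-! ### The main theorem -/

theorem SymmFun.map_hProd {R B : Type*} [CommRing R] [Ring B] [Algebra R B]
    (G : SymmFun R →ₐ[R] B) (d : ℕ →₀ ℕ) (N : ℕ) (hN : d.support ⊆ Finset.range N) :
    G (SymmFun.hProd R d) = (((List.range N).map d).map fun k => G (SymmFun.h R k)).prod := by
  rw [SymmFun.hProd, finsupp_prod_eq_range_prod _ (SymmFun.h_zero R) d N hN]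
  change G ((List.range N).map fun i => SymmFun.h R (d i)).prod = _
  rw [map_list_prod, List.map_map, List.map_map]
  rfl

/-- The factors are taken in reverse order, as `Λ` is commutative, so that the largest color comes
first, as in `bijOn_multicolorings`. -/
theorem SymmFun.map_eProd {R B : Type*} [CommRing R] [Ring B] [Algebra R B]
    (G : SymmFun R →ₐ[R] B) (d : ℕ →₀ ℕ) (N : ℕ) (hN : d.support ⊆ Finset.range N) :
    G (SymmFun.eProd R d) = (List.ofFn fun i : Fin N => G (SymmFun.e R (d i.rev))).prod := by
  rw [SymmFun.eProd, finsupp_prod_eq_range_prod _ (SymmFun.e_zero R) d N hN, Finset.prod_range,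
    ← Equiv.prod_comp Fin.revPerm, ← List.prod_ofFn, map_list_prod, List.map_ofFn]
  rfl

open Classical in
theorem evalNil_prod_ncElem {P R : Type*} [Fintype P] [PartialOrder P] [CommRing R]
    (c : P → P → R) (g : quasiSymmetricFunctions c) {N : ℕ} (l : Fin N → ℕ) :
    evalNil c g (List.ofFn fun i => ncElem (letterOperator c) (l i)).prod =
      ∑ D ∈ Fintype.piFinset fun i => (wordsOfLength P (l i)).filter IsDecreasingWord,
        g.1 (List.ofFn D).flatten := by
  have h := (MultilinearMap.mkPiAlgebraFin R N
    (Module.End R (quasiSymmetricFunctions c))).map_sum_finset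
    (fun _ w => (w.map (letterOperator c)).prod)
    (fun i => (wordsOfLength P (l i)).filter IsDecreasingWord)
  simp only [MultilinearMap.mkPiAlgebraFin_apply] at h
  refine (congrArg (evalNil c g) h).trans ?_
  rw [map_sum]
  refine Finset.sum_congr rfl fun D _ => ?_
  rw [← evalNil_prod, List.map_flatten, List.prod_flatten, List.map_map, List.map_ofFn]
  rfl

/-- The product of elementary functions expands into tuples of decreasing words; `hg` discards those
of the wrong content, and the others correspond to multicolorings with exponent `d`. -/
theorem coeff_monomialSum_multicolorings {P R : Type*} [Fintype P] [DecidableEq P] [PartialOrder P]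
    [CommRing R] (c : P → P → R) (g : quasiSymmetricFunctions c) (β : Multiset P)
    (hg : ∀ w : List P, (w : Multiset P) ≠ β → g.1 w = 0) (wt : (Blowup β → ℕ) → R)
    {srt : Finset P → List P} (hs : IsArrangement srt)
    (hwt : ∀ κ ∈ multicolorings β, ∀ N : ℕ, (∀ x, κ x < N) →
      ((List.ofFn fun i : Fin N => srt (colorLetters κ i.rev)).flatten : Multiset P) = β →
      wt κ = g.1 (List.ofFn fun i : Fin N => srt (colorLetters κ i.rev)).flatten)
    (d : ℕ →₀ ℕ) (N : ℕ) (hN : d.support ⊆ Finset.range N) :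
    MvPowerSeries.coeff d (monomialSum (multicolorings β) wt) =
      evalNil c g (List.ofFn fun i : Fin N => ncElem (letterOperator c) (d i.rev)).prod := by
  classical
  have hbij := bijOn_multicolorings (β := β) hs d N hN
  rw [evalNil_prod_ncElem]
  refine (finsum_mem_eq_of_bijOn (g := fun D : Fin N → List P => g.1 (List.ofFn D).flatten) _ hbij
    fun κ hκ => ?_).trans ?_
  · exact hwt κ hκ.1 N (lt_of_monomialExponent_eq hN hκ.2) (hbij.1 hκ).2
  · have hset : {D : Fin N → List P | (∀ i, IsDecreasingWord (D i) ∧ (D i).length = d i.rev) ∧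
        ((List.ofFn D).flatten : Multiset P) = β} =
        (((Fintype.piFinset fun i : Fin N =>
          (wordsOfLength P (d i.rev)).filter IsDecreasingWord).filter fun D =>
            ((List.ofFn D).flatten : Multiset P) = β : Finset (Fin N → List P)) :
              Set (Fin N → List P)) := by
      ext D
      simp only [Set.mem_ofPred_eq, Finset.mem_coe, Finset.mem_filter, Fintype.mem_piFinset,
        mem_wordsOfLength]
      exact and_congr_left fun _ => forall_congr' fun i => and_comm
    rw [hset, finsum_mem_coe_finset, Finset.sum_filter]
    refine Finset.sum_congr rfl fun D _ => ?_
    split_ifs with h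
    · rfl
    · exact (hg _ h).symm

theorem coeff_wordQuasisymmetric_content {P R : Type*} [Fintype P] [DecidableEq P] [PartialOrder P]
    [CommRing R] (c : P → P → R) (g : quasiSymmetricFunctions c) (β : Multiset P)
    (hg : ∀ w : List P, (w : Multiset P) ≠ β → g.1 w = 0)
    (d : ℕ →₀ ℕ) (N : ℕ) (hN : d.support ⊆ Finset.range N) :
    MvPowerSeries.coeff d
        (wordQuasisymmetric (∑ w ∈ wordsOfContent β, Finsupp.single w (g.1 w))) =
      evalNil c g (((List.range N).map d).map (ncHomog (letterOperator c))).prod := by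
  classical
  rw [coeff_wordQuasisymmetric _ _ d N hN]
  change _ = evalNil c g
    (((List.range N).map d).map fun k => wordSum (letterOperator c) k IsDescentFree).prod
  rw [prod_map_wordSum, evalNil_wordSum, sum_map_range d N hN]
  have h : ∀ w : List P, w ∉ wordsOfContent β → g.1 w = 0 := fun w hw =>
    hg w fun h => hw ((mem_wordsOfContent β w).2 h)
  rw [Finset.sum_filter, Finset.sum_filter]
  refine (Finset.sum_congr_of_eq_on_inter ?_ ?_ ?_)
  · intro w _ hw
    rw [mem_wordsOfLength] at hw
    exact if_neg fun h => hw h.1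
  · intro w _ hw
    rw [h w hw, ite_self]
  · intro w _ hw
    rw [mem_wordsOfLength] at hw
    simp [hw]

/-- The common part of (i) and (ii), for any swap factors `c` and weight `g` for which the
noncommutative elementary functions commute. -/
theorem omega_multicolored_of_commute {P R : Type*} [Fintype P] [DecidableEq P] [PartialOrder P]
    [CommRing R] (c : P → P → R) (g : quasiSymmetricFunctions c) (β : Multiset P)
    (hg : ∀ w : List P, (w : Multiset P) ≠ β → g.1 w = 0) (wt : (Blowup β → ℕ) → R)
    {srt : Finset P → List P} (hs : IsArrangement srt)
    (hwt : ∀ κ ∈ multicolorings β, ∀ N : ℕ, (∀ x, κ x < N) →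
      ((List.ofFn fun i : Fin N => srt (colorLetters κ i.rev)).flatten : Multiset P) = β →
      wt κ = g.1 (List.ofFn fun i : Fin N => srt (colorLetters κ i.rev)).flatten)
    (hcomm : ∀ i j, ncElem (letterOperator c) i * ncElem (letterOperator c) j =
      ncElem (letterOperator c) j * ncElem (letterOperator c) i) :
    ∃ hX : monomialSum (multicolorings β) wt ∈ SymmFun R,
      wordQuasisymmetric (∑ w ∈ wordsOfContent β, Finsupp.single w (g.1 w)) =
        (SymmFun.omega R ⟨monomialSum (multicolorings β) wt, hX⟩ : MvPowerSeries ℕ R) := by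
  obtain ⟨G, hG⟩ := SymmFun.exists_algHom (R := R) (ncElem (letterOperator c)) (ncElem_zero _)
    hcomm
  let ψ : SymmFun R →ₗ[R] R := (evalNil c g).comp G.toLinearMap
  have hE : ∀ d, MvPowerSeries.coeff d (monomialSum (multicolorings β) wt) =
      ψ (SymmFun.eProd R d) := by
    intro d
    obtain ⟨N, hN⟩ := finsupp_exists_support_subset_range d
    rw [coeff_monomialSum_multicolorings c g β hg wt hs hwt d N hN]
    change _ = evalNil c g (G (SymmFun.eProd R d))
    rw [SymmFun.map_eProd (B := Module.End R (quasiSymmetricFunctions c)) G d N hN]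
    simp only [hG]
  have hX : monomialSum (multicolorings β) wt ∈ SymmFun R := by
    refine mem_symmFun_of_coeff (fun σ d => ?_) (Fintype.card (Blowup β)) fun d hd => ?_
    -- Permuting the exponent only permutes the factors of `e_d`.
    · rw [hE, hE, SymmFun.eProd, SymmFun.eProd, Finsupp.prod_embDomain]
    · obtain ⟨κ, hκ, -⟩ := exists_ne_zero_of_finsum_mem_ne_zero hd
      rw [← hκ.2, monomialExponent, map_sum]
      simp
  refine ⟨hX, ?_⟩
  ext d
  obtain ⟨N, hN⟩ := finsupp_exists_support_subset_range d
  rw [SymmFun.coeff_omega_of_coeff_eq _ ψ hE d, coeff_wordQuasisymmetric_content c g β hg d N hN]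
  change _ = evalNil c g (G (SymmFun.hProd R d))
  rw [SymmFun.map_hProd (B := Module.End R (quasiSymmetricFunctions c)) G d N hN]
  simp only [SymmFun.map_h_eq_ncHomog (letterOperator c) G hG]

open Classical in
/-- The factors by which `t^{inv_P(w)}` changes if two neighbouring letters are interchanged. -/
noncomputable def swapFactor {P : Type*} [PartialOrder P] (lt : P → P → Prop) (a b : P) :
    RatFunc ℚ :=
  if lt a b ∧ IncompOrEq a b then RatFunc.X else
    if lt b a ∧ IncompOrEq b a then RatFunc.X⁻¹ else 1

theorem pow_incompInversions_mem {P : Type*} [DecidableEq P] [PartialOrder P] {lt : P → P → Prop}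
    (H : IsNaturalUnitIntervalOrder P lt) (β : Multiset P) :
    (fun w : List P => if (w : Multiset P) = β then
      (RatFunc.X : RatFunc ℚ) ^ incompInversions lt w else 0) ∈
        quasiSymmetricFunctions (swapFactor lt) := by
  intro s t a b
  have hperm : ((s ++ b :: a :: t : List P) : Multiset P) = (s ++ a :: b :: t : List P) :=
    Multiset.coe_eq_coe.2 (List.Perm.append_left s (List.Perm.swap a b t))
  simp only [hperm]
  by_cases hβ : ((s ++ a :: b :: t : List P) : Multiset P) = β
  swap
  · rw [if_neg hβ, if_neg hβ, mul_zero]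
  rw [if_pos hβ, if_pos hβ, swapFactor]
  have h0 : (RatFunc.X : RatFunc ℚ) ≠ 0 := RatFunc.X_ne_zero
  by_cases h1 : lt a b ∧ IncompOrEq a b
  · rw [if_pos h1, (incompInversions_swap lt s t a b (H.asymm h1.1)).1 h1, pow_succ']
  rw [if_neg h1]
  -- If the word on the right has the inversion, the swap removes it; this is why `X` must be
  -- invertible.
  by_cases h2 : lt b a ∧ IncompOrEq b a
  · rw [if_pos h2, (incompInversions_swap lt s t b a (H.asymm h2.1)).1 h2, pow_succ',
      inv_mul_cancel_left₀ h0]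
  rw [if_neg h2, one_mul]
  by_cases h3 : lt b a
  · rw [(incompInversions_swap lt s t b a (H.asymm h3)).2 h2]
  · rw [(incompInversions_swap lt s t a b h3).2 h1]

theorem mainTheorem12 {P : Type*} [Fintype P] [DecidableEq P] [PartialOrder P] (β : Multiset P) :
    (∃ hX : multicoloredChromatic β ∈ SymmFun ℤ,
      wordQuasisymmetric (contentSum β) =
        (SymmFun.omega ℤ ⟨multicoloredChromatic β, hX⟩ : MvPowerSeries ℕ ℤ)) ∧
    ∀ lt : P → P → Prop, IsNaturalUnitIntervalOrder P lt →
      ∃ hX : multicoloredChromaticT lt β ∈ SymmFun (RatFunc ℚ),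
        wordQuasisymmetric (contentSumT lt β) =
          (SymmFun.omega (RatFunc ℚ) ⟨multicoloredChromaticT lt β, hX⟩ :
            MvPowerSeries ℕ (RatFunc ℚ)) := by
  classical
  obtain ⟨srt, hs⟩ := exists_isArrangement P
  constructor
  -- With trivial factors all letter operators commute, and `g` is the indicator function of the
  -- content `β`.
  · let c : P → P → ℤ := fun _ _ => 1
    let g : quasiSymmetricFunctions c := ⟨fun w => if (w : Multiset P) = β then 1 else 0, by
      intro s t a b
      have hperm : ((s ++ b :: a :: t : List P) : Multiset P) = (s ++ a :: b :: t : List P) :=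
        Multiset.coe_eq_coe.2 (List.Perm.append_left s (List.Perm.swap a b t))
      simp only [hperm, c, one_mul]⟩
    obtain ⟨hX, h⟩ := omega_multicolored_of_commute c g β (fun w hw => if_neg hw) (fun _ => 1) hs
      (fun κ _ N _ h => (if_pos h).symm)
      (fun i j => commute_wordSum _ (fun a b => by
        have := letterOperator_mul c b a
        rwa [one_smul] at this) _ _ _ _)
    refine ⟨hX, Eq.trans ?_ h⟩
    congr 1
    refine Finset.sum_congr rfl fun w hw => ?_
    rw [mem_wordsOfContent] at hw
    simp only [g, if_pos hw]
  · intro lt H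
    have hirr : ∀ a b, lt a b → IncompOrEq a b → swapFactor lt b a = RatFunc.X⁻¹ := by
      intro a b h1 h2
      rw [swapFactor, if_neg fun h => H.asymm h1 h.1, if_pos ⟨h1, h2⟩]
    let g : quasiSymmetricFunctions (swapFactor lt) := ⟨_, pow_incompInversions_mem H β⟩
    obtain ⟨hX, h⟩ := omega_multicolored_of_commute (swapFactor lt) g β (fun w hw => if_neg hw)
      (fun κ => RatFunc.X ^ ascents (Blowup.totalLT lt β) κ) hs
      (fun κ hκ N hN h => by
        rw [ascents_eq_incompInversions lt hs hκ hN]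
        exact (if_pos h).symm)
      (H.commute_ncElem RatFunc.X⁻¹ _ (fun a b hab => by
        rw [letterOperator_mul, swapFactor, if_neg fun h => h.2.2 hab, if_neg fun h => h.2.1 hab,
          one_smul])
        fun a b h1 h2 => by rw [letterOperator_mul, hirr a b h1 h2])
    refine ⟨hX, Eq.trans ?_ h⟩
    congr 1
    refine Finset.sum_congr rfl fun w hw => ?_
    rw [mem_wordsOfContent] at hw
    simp only [g, if_pos hw]
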